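/- Let $(M^4,g)$ be a complete smooth $4$-dimensional Riemannian manifold with Levi-Civita connection $\nabla$, and let $f:M\to\mathbb{R}$ be a smooth function such that $$\mathrm{Ric}+\nabla^2 f=\tfrac12 g,\qquad |\nabla f|^2=f,$$ i.e. $(M,g,f)$ is a normalized complete gradient shrinking Ricci soliton. Assume that the scalar curvature is constant, $S=1$. Write $\Delta_f u=\Delta u-\langle\nabla f,\nabla u\rangle$ and, in an orthonormal basis with $R_{ij}=\mathrm{Ric}(e_i,e_j)$ (summing over repeated indices), $\mathrm{tr}(\mathrm{Ric}^3)=R_{ij}R_{jk}R_{ki}$. Then, at every point of $M$: (i) $\displaystyle \Delta_f\,\mathrm{tr}(\mathrm{Ric}^3)=4\,\mathrm{tr}(\mathrm{Ric}^3)-1-\tfrac32|\nabla\mathrm{Ric}|^2+6\,(\nabla\mathrm{Ric})*(\nabla\mathrm{Ric})*\mathrm{Ric}$, where $(\nabla\mathrm{Ric})*(\nabla\mathrm{Ric})*\mathrm{Ric}=(\nabla_sR_{ij})(\nabla_sR_{jk})R_{ki}$ in any orthonormal basis. (ii) $\mathrm{Ric}\ge 0$, and $\displaystyle \Delta_f\,\mathrm{tr}(\mathrm{Ric}^3)\ge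 4\,\mathrm{tr}(\mathrm{Ric}^3)-1-\tfrac32|\nabla\mathrm{Ric}|^2$. -/

import Mathlib

open Bundle VectorField
open scoped Manifold ContDiff

noncomputable section SolitonGeometry

/-! Riemannian geometry of a manifold `M` whose tangent spaces carry inner products.
`FiberBundle.extend` extends a tangent vector at `x` to a vector field that is smooth near `x`. -/

variable {E : Type*} [NormedAddCommGroup E] [NormedSpace ℝ E] [FiniteDimensional ℝ E]
  {H : Type*} [TopologicalSpace H] {I : ModelWithCorners ℝ E H}
  {M : Type*} [TopologicalSpace M] [ChartedSpace H M] [IsManifold I ∞ M]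
  [RiemannianBundle (fun x : M ↦ TangentSpace I x)]

variable (I) in
/-- An orthonormal basis of the tangent space at `x`. All traces below are independent of the
choice of orthonormal basis. -/
def frame (x : M) :
    OrthonormalBasis (Fin (Module.finrank ℝ (TangentSpace I x))) ℝ (TangentSpace I x) :=
  letI : FiniteDimensional ℝ (TangentSpace I x) :=
    inferInstanceAs (FiniteDimensional ℝ E)
  stdOrthonormalBasis ℝ (TangentSpace I x)

/-- The derivative at `x`, in the direction `v`, of the function `y ↦ ⟨Y y, Z y⟩`. -/
def derivInner (Y Z : ∀ x : M, TangentSpace I x) (x : M) (v : TangentSpace I x) : ℝ :=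
  mvfderiv I (fun y : M ↦ inner ℝ (Y y) (Z y)) x v

/-- The right-hand side of the Koszul formula, i.e. `⟨∇_X Y, Z⟩` at `x`. -/
def koszul (X Y Z : ∀ x : M, TangentSpace I x) (x : M) : ℝ :=
  (1 / 2) * (derivInner Y Z x (X x) + derivInner Z X x (Y x) - derivInner X Y x (Z x)
    + inner ℝ (mlieBracket I X Y x) (Z x)
    - inner ℝ (mlieBracket I X Z x) (Y x)
    - inner ℝ (mlieBracket I Y Z x) (X x))

/-- The Levi-Civita connection: `nabla Y x v` is `∇_v Y` at `x`, the vector whose inner products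
with the tangent vectors at `x` are given by the Koszul formula. -/
def nabla (Y : ∀ x : M, TangentSpace I x) (x : M) (v : TangentSpace I x) :
    TangentSpace I x :=
  ∑ i, koszul (FiberBundle.extend E v) Y
    (FiberBundle.extend E (frame I x i)) x • frame I x i

/-- The curvature `Rm(a, b) c = ∇_b ∇_a c - ∇_a ∇_b c + ∇_[a, b] c`. -/
def riem (x : M) (a b c : TangentSpace I x) : TangentSpace I x :=
  let A := FiberBundle.extend E a
  let B := FiberBundle.extend E b
  let C := FiberBundle.extend E c
  nabla (fun y ↦ nabla C y (A y)) x b - nabla (fun y ↦ nabla C y (B y)) x a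
    + nabla C x (mlieBracket I A B x)

/-- The Ricci tensor `Ric(a, b) = ∑ i, ⟨Rm(a, e i) b, e i⟩`. -/
def ric (x : M) (a b : TangentSpace I x) : ℝ :=
  ∑ i, inner ℝ (riem x a (frame I x i) b) (frame I x i)

variable (I) in
/-- The scalar curvature, as the trace of the Ricci tensor. -/
def scal (x : M) : ℝ := ∑ i, ric x (frame I x i) (frame I x i)

variable (I) in
/-- `tr (Ric³) = R_ij R_jk R_ki` in an orthonormal basis. -/
def trRicCubed (x : M) : ℝ :=
  ∑ i, ∑ j, ∑ k, ric x (frame I x i) (frame I x j) * ric x (frame I x j) (frame I x k)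
    * ric x (frame I x k) (frame I x i)

/-- The covariant derivative of the Ricci tensor:
`(∇_v Ric)(a, b) = v (Ric(A, B)) - Ric(∇_v A, b) - Ric(a, ∇_v B)` where `A`, `B` extend `a`, `b`. -/
def nablaRic (x : M) (v a b : TangentSpace I x) : ℝ :=
  let A := FiberBundle.extend E a
  let B := FiberBundle.extend E b
  mvfderiv I (fun y : M ↦ ric y (A y) (B y)) x v - ric x (nabla A x v) b
    - ric x a (nabla B x v)

variable (I) in
/-- `|∇ Ric|²`. -/
def nablaRicNormSq (x : M) : ℝ :=
  ∑ s, ∑ i, ∑ j, nablaRic x (frame I x s) (frame I x i) (frame I x j) ^ 2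

variable (I) in
/-- The gradient of a function, `⟨∇u, v⟩ = du(v)`. -/
def grad (u : M → ℝ) (x : M) : TangentSpace I x :=
  ∑ i, mvfderiv I u x (frame I x i) • frame I x i

/-- The Hessian `∇²u(a, b) = ⟨∇_a ∇u, b⟩`. -/
def hess (u : M → ℝ) (x : M) (a b : TangentSpace I x) : ℝ :=
  inner ℝ (nabla (grad I u) x a) b

variable (I) in
/-- The drifted Laplacian `Δ_f u = Δ u - ⟨∇f, ∇u⟩`, with `Δ u` the trace of the Hessian of `u`. -/
def driftLaplacian (f u : M → ℝ) (x : M) : ℝ :=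
  ∑ i, hess u x (frame I x i) (frame I x i) - inner ℝ (grad I f x) (grad I u x)

variable (I) in
/-- `f` is a smooth potential making `M` a gradient shrinking Ricci soliton with constant `1/2`,
`Ric + ∇²f = g / 2`, and is normalized by `|∇f|² = f`. -/
structure IsNormalizedShrinkingSoliton (f : M → ℝ) : Prop where
  smooth : ContMDiff I 𝓘(ℝ, ℝ) ∞ f
  soliton : ∀ (x : M) (a b : TangentSpace I x),
    ric x a b + hess f x a b = (1 / 2) * inner ℝ a b
  normalized : ∀ x : M, ‖grad I f x‖ ^ 2 = f x

end SolitonGeometry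

/-! Everything is a computation at one point. Differentiating |∇f|² = f and inserting ∇²f = g/2 −
Ric gives Ric(∇f) = 0 (`ricM_mulVec_gr`); the Ricci identity for ∇f gives ∇_i R_jk − ∇_j R_ik =
R_ijkl f_l (`dm_ricM_sub`). As S is constant, tracing the latter shows div Ric = 0, and contracting
the derivative of Ric(∇f) = 0 gives |Ric|² = S/2 = 1/2 (`trace_sq`). The divergence of the
commutation formula is Δ_f Ric = Ric − 2 Rm*Ric with (Rm*Ric)_jk = R_ijkl R_il (`drift_lapM_ricM`).

Hence Δ_f tr Ric³ = 3 tr Ric³ − 6 tr(Ric² Rm*Ric) + 6 ∇Ric*∇Ric*Ric, while constancy of |Ric|² gives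
|∇Ric|² = 2 tr(Ric Rm*Ric) − 1/2. It remains to trade one curvature term for the other. In an
eigenbasis of Ric both involve only the numbers K_ij = R_ijji, whose row sums are the eigenvalues
λ_j. Some λ_p vanishes (`exists_eigenvalue_eq_zero`): otherwise ∇f = 0 at the point, every λ is 1/2
and S = 2. The other three have sum 1 and square sum 1/2, so they are nonnegative, and
`curvature_sum_identity` performs the trade. Finally Ric ≥ 0 makes the cubic gradient term
nonnegative, which is the inequality.

The tensor calculus takes place in `FrameAlgebra`, over an abstract commutative algebra;
`OrthoFrame.alg` realizes it by smooth functions on the domain of a local orthonormal frame. The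
geometric definitions use bases chosen separately at each point and local extensions of vectors, so
each quantity is first rewritten in components of a smooth frame. -/

/-! ### Tensor calculus and curvature identities in a moving frame. -/

/-- The calculus of a Riemannian metric in a moving orthonormal frame: derivations `D i` of a
commutative algebra of functions, and the connection coefficients `Γ i j k = ⟨∇_i e_j, e_k⟩` of a
torsion-free metric connection. -/
structure FrameAlgebra (A ι : Type*) [CommRing A] [Algebra ℝ A] [Fintype ι] where
  D : ι → Derivation ℝ A A
  Γ : ι → ι → ι → A
  skew : ∀ i j k, Γ i j k = -Γ i k j
  bracket : ∀ i j a, D i (D j a) - D j (D i a) = ∑ m, (Γ i j m - Γ j i m) * D m a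
  jacobi : ∀ i j k l,
    D i (Γ j k l - Γ k j l) + D j (Γ k i l - Γ i k l) + D k (Γ i j l - Γ j i l)
      + ∑ m, ((Γ j k m - Γ k j m) * (Γ i m l - Γ m i l)
        + (Γ k i m - Γ i k m) * (Γ j m l - Γ m j l)
        + (Γ i j m - Γ j i m) * (Γ k m l - Γ m k l)) = 0

namespace FrameAlgebra

open Matrix

variable {A ι : Type*} [CommRing A] [Algebra ℝ A] [Fintype ι] (F : FrameAlgebra A ι)

/-- The structure coefficients of the frame. -/
def c (i j k : ι) : A := F.Γ i j k - F.Γ j i k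

/-- Covariant derivative of a vector. -/
def dv (i : ι) (v : ι → A) (k : ι) : A := F.D i (v k) - ∑ l, F.Γ i k l * v l

/-- Covariant derivative of a tensor of rank two. -/
def dm (i : ι) (T : Matrix ι ι A) : Matrix ι ι A :=
  fun j k ↦ F.dv i (T j) k - ∑ l, F.Γ i j l * T l k

/-- Covariant derivative of a tensor of rank three. -/
def d3 (i : ι) (T : ι → Matrix ι ι A) (j k l : ι) : A :=
  F.dm i (T j) k l - ∑ m, F.Γ i j m * T m k l

/-- Covariant derivative of a tensor of rank four. -/
def d4 (i : ι) (T : ι → ι → Matrix ι ι A) (j k l p : ι) : A :=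
  F.d3 i (T j) k l p - ∑ m, F.Γ i j m * T m k l p

/-- The components `⟨R(e_i, e_j) e_k, e_l⟩` of the curvature. -/
def R (i j : ι) : Matrix ι ι A := fun k l ↦
  F.D i (F.Γ j k l) - F.D j (F.Γ i k l)
    + ∑ m, (F.Γ j k m * F.Γ i m l - F.Γ i k m * F.Γ j m l) - ∑ m, F.c i j m * F.Γ m k l

/-- The components of the Ricci tensor. -/
def ricM : Matrix ι ι A := fun j k ↦ ∑ i, F.R i j k i

/-- Metric compatibility, in the form that lets contractions commute with covariant derivatives. -/
theorem sum_Γ_contract (s : ι) (X : ι → ι → A) :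
    ∑ i, ∑ m, F.Γ s i m * X m i + ∑ i, ∑ m, F.Γ s i m * X i m = 0 := by
  rw [Finset.sum_comm, ← Finset.sum_add_distrib]
  refine Finset.sum_eq_zero fun i _ ↦ ?_
  rw [← Finset.sum_add_distrib]
  refine Finset.sum_eq_zero fun m _ ↦ ?_
  rw [F.skew s m i]; ring

theorem R_swap (i j k l : ι) : F.R i j k l = -F.R j i k l := by
  simp only [R, c, sub_mul, Finset.sum_sub_distrib]; ring

theorem R_skew (i j k l : ι) : F.R i j k l = -F.R i j l k := by
  simp only [R, F.skew _ k l, map_neg, mul_neg, Finset.sum_neg_distrib, Finset.sum_sub_distrib]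
  have h1 : ∀ a b : ι, ∑ m, F.Γ a k m * F.Γ b m l = ∑ m, F.Γ b l m * F.Γ a m k := fun a b ↦
    Finset.sum_congr rfl fun m _ ↦ by rw [F.skew a k m, F.skew b m l]; ring
  rw [h1, h1]; ring

theorem R_bianchi (i j k l : ι) : F.R i j k l + F.R j k i l + F.R k i j l = 0 := by
  have h := F.jacobi i j k l
  simp only [map_sub, Finset.sum_add_distrib] at h
  simp only [R, c]
  have e : ∀ a b c' : ι, ∑ m, (F.Γ a b m - F.Γ b a m) * (F.Γ c' m l - F.Γ m c' l)
      = ∑ m, F.Γ a b m * F.Γ c' m l - ∑ m, F.Γ b a m * F.Γ c' m l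
        - ∑ m, (F.Γ a b m - F.Γ b a m) * F.Γ m c' l := fun a b c' ↦ by
    simp only [← Finset.sum_sub_distrib]
    exact Finset.sum_congr rfl fun m _ ↦ by ring
  rw [e, e, e] at h
  simp only [Finset.sum_sub_distrib] at h ⊢
  linear_combination h

/-- Two cyclic identities minus two others leave twice the difference, up to the skew symmetries.
The factor 2 is cancelled with the real scalar 1/2, as `A` is only a commutative ℝ-algebra. -/
theorem R_pair (i j k l : ι) : F.R i j k l = F.R k l i j := by
  have h1 := F.R_bianchi i j k l
  have h2 := F.R_bianchi j k l i
  have h3 := F.R_bianchi k l i j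
  have h4 := F.R_bianchi l i j k
  have e : (2 : ℝ) • (F.R i j k l - F.R k l i j) = 0 := by
    rw [two_smul]
    linear_combination h1 + h2 - h3 - h4 + F.R_skew i j k l - F.R_skew k l i j - F.R_skew j k i l
      + F.R_skew l i j k + F.R_swap i k l j - F.R_skew k i l j + F.R_swap j l i k - F.R_skew l j i k
  have := congrArg ((1 / 2 : ℝ) • ·) e
  simp only [smul_smul, smul_zero] at this
  norm_num at this
  linear_combination this

theorem ricM_symm (j k : ι) : F.ricM j k = F.ricM k j := by
  refine Finset.sum_congr rfl fun i _ ↦ ?_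
  rw [F.R_pair, F.R_swap, F.R_skew]; ring

theorem dv_add (i : ι) (v w : ι → A) : F.dv i (v + w) = F.dv i v + F.dv i w := by
  ext k
  simp only [dv, Pi.add_apply, map_add, mul_add, Finset.sum_add_distrib]; ring

theorem dv_zero (i : ι) : F.dv i 0 = 0 := by
  ext k
  simp [dv]

theorem dv_smul (i : ι) (a : A) (v : ι → A) : F.dv i (a • v) = F.D i a • v + a • F.dv i v := by
  ext k
  simp only [dv, Pi.add_apply, Pi.smul_apply, smul_eq_mul, Derivation.leibniz, mul_sub,
    Finset.mul_sum]
  simp only [mul_left_comm a]; ring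

theorem dv_neg (i : ι) (v : ι → A) : F.dv i (-v) = -F.dv i v := by
  rw [eq_neg_iff_add_eq_zero, ← dv_add, neg_add_cancel, dv_zero]

theorem dv_sub (i : ι) (v w : ι → A) : F.dv i (v - w) = F.dv i v - F.dv i w := by
  rw [sub_eq_add_neg, dv_add, dv_neg, sub_eq_add_neg]

theorem dv_sum {κ : Type*} (s : Finset κ) (i : ι) (v : κ → ι → A) :
    F.dv i (∑ m ∈ s, v m) = ∑ m ∈ s, F.dv i (v m) :=
  map_sum (⟨⟨F.dv i, F.dv_zero i⟩, F.dv_add i⟩ : (ι → A) →+ (ι → A)) _ _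

/-- The Ricci identity for vectors. -/
theorem dv_comm (i j : ι) (v : ι → A) :
    F.dv i (F.dv j v) - F.dv j (F.dv i v) = ∑ m, F.c i j m • F.dv m v - F.R i j *ᵥ v := by
  ext k
  have hb : _ = ∑ m, F.c i j m * _ := F.bracket i j (v k)
  have h1 : ∀ a b : ι, ∑ l, F.Γ a k l * ∑ m, F.Γ b l m * v m
      = ∑ l, (∑ m, F.Γ a k m * F.Γ b m l) * v l := fun a b ↦ by
    simp only [Finset.mul_sum, Finset.sum_mul]
    rw [Finset.sum_comm]
    exact Finset.sum_congr rfl fun _ _ ↦ Finset.sum_congr rfl fun _ _ ↦ by ring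
  have h2 : ∑ m, F.c i j m * ∑ l, F.Γ m k l * v l
      = ∑ l, (∑ m, F.c i j m * F.Γ m k l) * v l := by
    simp only [Finset.mul_sum, Finset.sum_mul]
    rw [Finset.sum_comm]
    exact Finset.sum_congr rfl fun _ _ ↦ Finset.sum_congr rfl fun _ _ ↦ by ring
  simp only [dv, R, Pi.sub_apply, Finset.sum_apply, Pi.smul_apply, smul_eq_mul, mulVec,
    dotProduct, map_sub, map_sum, Derivation.leibniz, mul_sub, Finset.sum_sub_distrib,
    Finset.sum_add_distrib, h1, h2, sub_mul, add_mul]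
  simp only [mul_comm (v _)]
  linear_combination hb

theorem dm_mulVec (i : ι) (T : Matrix ι ι A) (v : ι → A) :
    F.dm i T *ᵥ v = F.dv i (T *ᵥ v) - T *ᵥ F.dv i v := by
  ext j
  have h1 : ∑ x, (∑ l, F.Γ i x l * T j l) * v x = - ∑ l, T j l * ∑ x, F.Γ i l x * v x := by
    simp only [Finset.mul_sum, Finset.sum_mul]
    rw [Finset.sum_comm, ← Finset.sum_neg_distrib]
    refine Finset.sum_congr rfl fun l _ ↦ ?_
    rw [← Finset.sum_neg_distrib]
    exact Finset.sum_congr rfl fun x _ ↦ by rw [F.skew i x l]; ring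
  have h2 : ∑ x, (∑ l, F.Γ i j l * T l x) * v x = ∑ l, F.Γ i j l * ∑ x, T l x * v x := by
    simp only [Finset.mul_sum, Finset.sum_mul]
    rw [Finset.sum_comm]
    exact Finset.sum_congr rfl fun _ _ ↦ Finset.sum_congr rfl fun _ _ ↦ by ring
  simp only [mulVec, dotProduct, dm, dv, Pi.sub_apply, map_sum, Derivation.leibniz, sub_mul,
    mul_sub, Finset.sum_sub_distrib, Finset.sum_add_distrib, smul_eq_mul, h1, h2]
  simp only [mul_comm (v _)]; ring

theorem matrix_ext_mulVec {A ι : Type*} [CommRing A] [Fintype ι] [DecidableEq ι] {S T : Matrix ι ι A} (h : ∀ v, S *ᵥ v = T *ᵥ v) :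
    S = T := by
  ext i j
  simpa using congrFun (h (Pi.single j 1)) i

/-- The Ricci identity writes `R i j` through commutators of the operators `dv`. In the cyclic sum
the third-order terms cancel, and the Jacobi identity of the frame removes the first-order ones.
Only the last two slots of `R` are differentiated covariantly here, hence the structure coefficients
on the right. -/
theorem sum_d_R_cyclic [DecidableEq ι] (s i j : ι) :
    F.dm s (F.R i j) + F.dm i (F.R j s) + F.dm j (F.R s i)
      = ∑ m, (F.c i j m • F.R m s + F.c j s m • F.R m i + F.c s i m • F.R m j) := by
  refine matrix_ext_mulVec fun v ↦ ?_
  have hR : ∀ (a b : ι) (w : ι → A), F.R a b *ᵥ w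
      = ∑ m, F.c a b m • F.dv m w - F.dv a (F.dv b w) + F.dv b (F.dv a w) := fun a b w ↦ by
    have := F.dv_comm a b w
    rw [sub_eq_iff_eq_add] at this
    rw [this]; abel
  have key : ∀ a b d : ι, F.dm a (F.R b d) *ᵥ v
      = ∑ m, F.D a (F.c b d m) • F.dv m v
        + ∑ m, F.c b d m • (∑ n, F.c a m n • F.dv n v - F.R a m *ᵥ v)
        - F.dv a (F.dv b (F.dv d v)) + F.dv a (F.dv d (F.dv b v))
        + F.dv b (F.dv d (F.dv a v)) - F.dv d (F.dv b (F.dv a v)) := fun a b d ↦ by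
    have h3 : ∑ m, F.c b d m • (∑ n, F.c a m n • F.dv n v - F.R a m *ᵥ v)
        = ∑ m, F.c b d m • F.dv a (F.dv m v) - ∑ m, F.c b d m • F.dv m (F.dv a v) := by
      rw [← Finset.sum_sub_distrib]
      refine Finset.sum_congr rfl fun m _ ↦ ?_
      rw [← F.dv_comm, smul_sub]
    rw [F.dm_mulVec, hR, hR, dv_add, dv_sub, dv_sum, h3]
    simp only [dv_smul, Finset.sum_add_distrib]
    abel
  have hj : ∀ n, F.D s (F.c i j n) + F.D i (F.c j s n) + F.D j (F.c s i n)
      + ∑ m, (F.c i j m * F.c s m n + F.c j s m * F.c i m n + F.c s i m * F.c j m n) = 0 :=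
    fun n ↦ F.jacobi s i j n
  have hn : ∀ a m, F.R a m *ᵥ v = -(F.R m a *ᵥ v) := fun a m ↦ by
    rw [← neg_mulVec]
    congr 1
    ext k l
    exact F.R_swap a m k l
  have hsum : ∀ a b d : ι, ∑ m, F.c b d m • (∑ n, F.c a m n • F.dv n v - F.R a m *ᵥ v)
      = ∑ n, (∑ m, F.c b d m * F.c a m n) • F.dv n v + ∑ m, F.c b d m • (F.R m a *ᵥ v) := by
    intro a b d
    simp only [hn a, sub_neg_eq_add, smul_add, Finset.smul_sum, smul_smul, Finset.sum_smul,
      Finset.sum_add_distrib]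
    rw [Finset.sum_comm]
  have hz : ∑ n, (F.D s (F.c i j n) • F.dv n v + F.D i (F.c j s n) • F.dv n v
      + F.D j (F.c s i n) • F.dv n v + (∑ m, F.c i j m * F.c s m n) • F.dv n v
      + (∑ m, F.c j s m * F.c i m n) • F.dv n v
      + (∑ m, F.c s i m * F.c j m n) • F.dv n v) = 0 := by
    refine Finset.sum_eq_zero fun n _ ↦ ?_
    simp only [← add_smul]
    have := hj n
    simp only [Finset.sum_add_distrib] at this
    rw [← zero_smul A (F.dv n v)]
    congr 1
    linear_combination this
  simp only [add_mulVec, key, hsum, sum_mulVec, smul_mulVec]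
  simp only [Finset.sum_add_distrib] at hz ⊢
  linear_combination (exp := 1) hz

/-- The second Bianchi identity. -/
theorem d4_R_cyclic [DecidableEq ι] (s i j k l : ι) :
    F.d4 s F.R i j k l + F.d4 i F.R j s k l
      + F.d4 j F.R s i k l = 0 := by
  have h := congrFun (congrFun (F.sum_d_R_cyclic s i j) k) l
  simp only [Matrix.add_apply, Matrix.sum_apply, Matrix.smul_apply, smul_eq_mul] at h
  simp only [d4, d3]
  -- Since `c` is the skew part of `Γ`, the structure coefficients are exactly the connection terms
  -- of the first two slots.
  have e : ∀ a b d m, F.Γ a b m * F.R d m k l = - (F.Γ a b m * F.R m d k l) := fun a b d m ↦ by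
    rw [F.R_swap d m]; ring
  simp only [e, Finset.sum_neg_distrib]
  simp only [c, sub_mul, Finset.sum_add_distrib, Finset.sum_sub_distrib] at h
  linear_combination h

theorem d4_apply (s : ι) (T : ι → ι → Matrix ι ι A) (i j k l : ι) :
    F.d4 s T i j k l = F.D s (T i j k l) - ∑ m, F.Γ s l m * T i j k m
      - ∑ m, F.Γ s k m * T i j m l - ∑ m, F.Γ s j m * T i m k l
      - ∑ m, F.Γ s i m * T m j k l := rfl

theorem dm_apply (s : ι) (T : Matrix ι ι A) (i j : ι) :
    F.dm s T i j = F.D s (T i j) - ∑ m, F.Γ s j m * T i m - ∑ m, F.Γ s i m * T m j := rfl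

theorem ricM_apply (j k : ι) : F.ricM j k = ∑ i, F.R i j k i := rfl

theorem sum_R_eq_neg_ricM (j k : ι) : ∑ i, F.R i j i k = -F.ricM j k := by
  rw [ricM_apply, ← Finset.sum_neg_distrib]
  exact Finset.sum_congr rfl fun i _ ↦ F.R_skew i j i k

theorem dm_ricM_symm (s j k : ι) : F.dm s F.ricM j k = F.dm s F.ricM k j := by
  simp only [dm_apply, F.ricM_symm _ j, F.ricM_symm k]; ring

theorem trace_dm (s : ι) (T : Matrix ι ι A) : (F.dm s T).trace = F.D s T.trace := by
  simp only [trace, diag, dm_apply, Finset.sum_sub_distrib, map_sum]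
  linear_combination -F.sum_Γ_contract s T

theorem d4_R_swap (s i j k l : ι) :
    F.d4 s F.R i j k l = -F.d4 s F.R j i k l := by
  simp only [d4_apply]
  simp only [F.R_swap i, F.R_swap _ j, mul_neg, Finset.sum_neg_distrib, map_neg]
  ring

theorem d4_R_skew (s i j k l : ι) :
    F.d4 s F.R i j k l = -F.d4 s F.R i j l k := by
  simp only [d4_apply]
  simp only [F.R_skew _ _ k, F.R_skew _ _ _ l, mul_neg, Finset.sum_neg_distrib, map_neg]
  ring

theorem d4_R_pair (s i j k l : ι) :
    F.d4 s F.R i j k l = F.d4 s F.R k l i j := by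
  simp only [d4_apply]
  simp only [fun m ↦ F.R_pair i j k m, fun m ↦ F.R_pair i j m l, fun m ↦ F.R_pair i m k l,
    fun m ↦ F.R_pair m j k l]
  ring

theorem sum_d4_R (s j k : ι) :
    ∑ i, F.d4 s F.R i j k i = F.dm s F.ricM j k := by
  have h := F.sum_Γ_contract s (fun m i ↦ F.R m j k i)
  have h1 : ∀ p (Y : ι → ι → A), ∑ i, ∑ m, F.Γ s p m * Y i m = ∑ m, F.Γ s p m * ∑ i, Y i m :=
    fun p Y ↦ by
      rw [Finset.sum_comm]
      simp only [Finset.mul_sum]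
  simp only [d4_apply, dm_apply, ricM, Finset.sum_sub_distrib, map_sum, h1]
  linear_combination -h

/-- The contracted second Bianchi identity for the divergence of the curvature. -/
theorem div_R [DecidableEq ι] (j k l : ι) :
    ∑ i, F.d4 i F.R i j k l = F.dm l F.ricM k j - F.dm k F.ricM l j := by
  rw [← sum_d4_R, ← sum_d4_R, ← Finset.sum_sub_distrib]
  refine Finset.sum_congr rfl fun i _ ↦ ?_
  -- Pair symmetry moves the contracted index into the last two slots, where the second Bianchi
  -- identity yields two Ricci contractions.
  have h := F.d4_R_cyclic i k l i j
  rw [F.d4_R_pair i i j k l]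
  rw [F.d4_R_swap k l i, F.d4_R_skew k i l, F.d4_R_skew l i k] at h
  linear_combination h

theorem sum_d3 (j k : ι) (N : ι → Matrix ι ι A) :
    ∑ i, F.d3 j N i i k = F.dv j (fun k ↦ ∑ i, N i i k) k := by
  have h := F.sum_Γ_contract j (fun m i ↦ N m i k)
  have h1 : ∑ i, ∑ m, F.Γ j k m * N i i m = ∑ m, F.Γ j k m * ∑ i, N i i m := by
    rw [Finset.sum_comm]
    simp only [Finset.mul_sum]
  simp only [d3, dm_apply, dv, Finset.sum_sub_distrib, map_sum, h1]
  linear_combination -h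

theorem dm_comm [DecidableEq ι] (s i : ι) (T : Matrix ι ι A) :
    F.dm s (F.dm i T) - F.dm i (F.dm s T)
      = ∑ m, F.c s i m • F.dm m T - F.R s i * T + T * F.R s i := by
  refine matrix_ext_mulVec fun v ↦ ?_
  have h1 := F.dv_comm s i (T *ᵥ v)
  have h2 := congrArg (T *ᵥ ·) (F.dv_comm s i v)
  simp only [mulVec_sub, mulVec_sum, mulVec_smul] at h2
  simp only [sub_mulVec, add_mulVec, sum_mulVec, smul_mulVec, dm_mulVec, ← mulVec_mulVec,
    dv_sub, smul_sub, Finset.sum_sub_distrib]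
  linear_combination (exp := 1) h1 - h2

/-- The Ricci identity for tensors of rank two. -/
theorem d3_comm [DecidableEq ι] (s i j k : ι) (T : Matrix ι ι A) :
    F.d3 s (fun a ↦ F.dm a T) i j k - F.d3 i (fun a ↦ F.dm a T) s j k
      = -∑ m, F.R s i j m * T m k - ∑ m, F.R s i k m * T j m := by
  have h := congrFun (congrFun (F.dm_comm s i T) j) k
  simp only [Matrix.add_apply, Matrix.sub_apply, Matrix.sum_apply, Matrix.smul_apply, smul_eq_mul,
    mul_apply, c, sub_mul, Finset.sum_sub_distrib] at h
  have h1 : ∑ m, T j m * F.R s i m k = -∑ m, F.R s i k m * T j m := by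
    rw [← Finset.sum_neg_distrib]
    exact Finset.sum_congr rfl fun m _ ↦ by rw [F.R_skew s i m k]; ring
  simp only [d3]
  linear_combination h + h1

/-- The Leibniz rule needed to take the divergence of R_ijkl f_l. -/
theorem d3_mulVec (s i j k : ι) (T : ι → ι → Matrix ι ι A) (v : ι → A) :
    F.d3 s (fun i ↦ Matrix.of fun j ↦ T i j *ᵥ v) i j k
      = ∑ l, F.d4 s T i j k l * v l + ∑ l, T i j k l * F.dv s v l := by
  have h := congrFun (F.dm_mulVec s (T i j) v) k
  have h1 : ∀ p (Y : ι → ι → A), ∑ m, F.Γ s p m * ∑ l, Y m l * v l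
      = ∑ l, (∑ m, F.Γ s p m * Y m l) * v l := fun p Y ↦ by
    simp only [Finset.mul_sum, Finset.sum_mul]
    rw [Finset.sum_comm]
    exact Finset.sum_congr rfl fun _ _ ↦ Finset.sum_congr rfl fun _ _ ↦ by ring
  have hd : F.d3 s (fun i ↦ Matrix.of fun j ↦ T i j *ᵥ v) i j k
      = F.dv s (T i j *ᵥ v) k - ∑ m, F.Γ s j m * ∑ l, T i m k l * v l
        - ∑ m, F.Γ s i m * ∑ l, T m j k l * v l := rfl
  have hm : ∀ (S : Matrix ι ι A) (w : ι → A), (S *ᵥ w) k = ∑ l, S k l * w l := fun _ _ ↦ rfl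
  rw [hd]
  simp only [Pi.sub_apply, hm (F.dm s (T i j)), hm (T i j) (F.dv s v)] at h
  simp only [d3, d4, dm, sub_mul, Finset.sum_sub_distrib, h1] at h ⊢
  linear_combination -h

theorem dm_mul [DecidableEq ι] (s : ι) (S T : Matrix ι ι A) :
    F.dm s (S * T) = F.dm s S * T + S * F.dm s T := by
  refine matrix_ext_mulVec fun v ↦ ?_
  simp only [add_mulVec, dm_mulVec, ← mulVec_mulVec, mulVec_sub]
  abel

theorem dm_add (s : ι) (S T : Matrix ι ι A) : F.dm s (S + T) = F.dm s S + F.dm s T := by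
  ext i j
  simp only [dm_apply, Matrix.add_apply, map_add, mul_add, Finset.sum_add_distrib]; ring

/-! ### Laplacians of functions and of tensors of rank two. -/

/-- The Laplacian of a function. -/
def lap (a : A) : A := ∑ i, (F.D i (F.D i a) - ∑ l, F.Γ i i l * F.D l a)

/-- The rough Laplacian of a tensor of rank two. -/
def lapM (T : Matrix ι ι A) : Matrix ι ι A :=
  ∑ i, (F.dm i (F.dm i T) - ∑ l, F.Γ i i l • F.dm l T)

theorem lapM_apply (T : Matrix ι ι A) (j k : ι) :
    F.lapM T j k = ∑ i, F.d3 i (fun a ↦ F.dm a T) i j k := by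
  simp [lapM, d3, Matrix.sum_apply]

theorem trace_lapM (T : Matrix ι ι A) : (F.lapM T).trace = F.lap T.trace := by
  simp only [lapM, lap, trace_sum, trace_sub, trace_smul, trace_dm, smul_eq_mul]

theorem lapM_mul [DecidableEq ι] (S T : Matrix ι ι A) :
    F.lapM (S * T) = F.lapM S * T + S * F.lapM T + (2 : A) • ∑ i, F.dm i S * F.dm i T := by
  simp only [lapM, dm_mul, dm_add, Finset.smul_sum, Finset.sum_mul, Finset.mul_sum, sub_mul,
    mul_sub, smul_add, smul_mul_assoc, mul_smul_comm, ← Finset.sum_add_distrib]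
  refine Finset.sum_congr rfl fun i _ ↦ ?_
  rw [Finset.sum_add_distrib]
  module

end FrameAlgebra

/-! ### Consequences of the soliton equations. -/

namespace FrameAlgebra

open Matrix

variable {A ι : Type*} [CommRing A] [Algebra ℝ A] [Fintype ι] [DecidableEq ι]
  (F : FrameAlgebra A ι)

/-- The differential of a function, in components. -/
def gr (f : A) (i : ι) : A := F.D i f

/-- The equations of a normalized gradient shrinking soliton of scalar curvature one. -/
structure IsSoliton (f : A) : Prop where
  eqn : ∀ i j, F.ricM i j + F.dv i (F.gr f) j = if i = j then algebraMap ℝ A (1 / 2) else 0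
  normalized : ∑ i, F.gr f i * F.gr f i = f
  scal : F.ricM.trace = 1

theorem eq_zero_of_add_self {a : A} (h : a + a = 0) : a = 0 := by
  have h2 : (2 : ℝ) • a = 0 := by rw [two_smul]; exact h
  simpa using congrArg ((1 / 2 : ℝ) • ·) h2

theorem half_add_half : algebraMap ℝ A (1 / 2) + algebraMap ℝ A (1 / 2) = 1 := by
  rw [← map_add]; norm_num

namespace IsSoliton

variable {F} {f : A} (h : F.IsSoliton f)
include h

/-- Differentiating |∇f|² = f gives 2 ∇²f(∇f) = ∇f, and ∇²f = g/2 − Ric. -/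
theorem ricM_mulVec_gr : F.ricM *ᵥ F.gr f = 0 := by
  ext i
  have h1 : F.gr f i = ∑ j, (F.gr f j * F.D i (F.gr f j) + F.gr f j * F.D i (F.gr f j)) := by
    conv_lhs => rw [gr, ← h.normalized]
    simp only [map_sum, Derivation.leibniz, smul_eq_mul]
  have h2 := F.sum_Γ_contract i (fun j l ↦ F.gr f j * F.gr f l)
  have h3 : ∑ j, F.ricM i j * F.gr f j + ∑ j, F.gr f j * F.D i (F.gr f j)
      - ∑ j, ∑ l, F.Γ i j l * (F.gr f j * F.gr f l)
      = algebraMap ℝ A (1 / 2) * F.gr f i := by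
    have : ∑ j, (F.ricM i j + F.dv i (F.gr f) j) * F.gr f j
        = algebraMap ℝ A (1 / 2) * F.gr f i := by
      simp [h.eqn]
    rw [← this]
    simp only [dv, add_mul, sub_mul, Finset.sum_add_distrib, Finset.sum_sub_distrib,
      Finset.sum_mul]
    simp only [mul_comm (F.gr f _) (F.D i _), mul_assoc, mul_comm (F.gr f _) (F.gr f _)]
    ring
  -- The skew Γ is paired with the symmetric f_j f_l.
  have h4 : ∑ j, ∑ l, F.Γ i j l * (F.gr f j * F.gr f l) = 0 := by
    refine eq_zero_of_add_self ?_
    conv_rhs => rw [← h2]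
    congr 1
    exact Finset.sum_congr rfl fun _ _ ↦ Finset.sum_congr rfl fun _ _ ↦ by ring
  change ∑ j, F.ricM i j * F.gr f j = 0
  refine eq_zero_of_add_self ?_
  rw [Finset.sum_add_distrib] at h1
  linear_combination 2 * h3 + 2 * h4 + h1 + F.gr f i * (half_add_half (A := A))

theorem dv_gr (i j : ι) : F.dv i (F.gr f) j
    = (if i = j then algebraMap ℝ A (1 / 2) else 0) - F.ricM i j := by
  rw [← h.eqn]; ring

/-- The Ricci identity for ∇f, with ∇²f = g/2 − Ric and g parallel. -/
theorem dm_ricM_sub (i j k : ι) :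
    F.dm i F.ricM j k - F.dm j F.ricM i k = ∑ l, F.R i j k l * F.gr f l := by
  have h1 := congrFun (F.dv_comm i j (F.gr f)) k
  have h2 : ∀ a b, F.dm a F.ricM b k = - F.dm a (Matrix.of fun i ↦ F.dv i (F.gr f)) b k := fun a b ↦ by
    have e : ∀ p q, (Matrix.of fun i ↦ F.dv i (F.gr f)) p q
      = (if p = q then algebraMap ℝ A (1 / 2) else 0) - F.ricM p q := h.dv_gr
    simp only [dm_apply, e, map_sub, apply_ite (F.D a), Derivation.map_algebraMap, map_zero,
      ite_self, mul_sub, Finset.sum_sub_distrib, mul_ite, mul_zero, Finset.sum_ite_eq,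
      Finset.sum_ite_eq', Finset.mem_univ, if_true]
    rw [F.skew a b k]; ring
  simp only [Pi.sub_apply, Finset.sum_apply, Pi.smul_apply, smul_eq_mul, mulVec, dotProduct, c,
    sub_mul, Finset.sum_sub_distrib] at h1
  rw [h2, h2]
  have h3 : ∀ a b, F.dm a (Matrix.of fun i ↦ F.dv i (F.gr f)) b k
      = F.dv a (F.dv b (F.gr f)) k - ∑ l, F.Γ a b l * F.dv l (F.gr f) k := fun _ _ ↦ rfl
  rw [h3, h3]
  linear_combination -h1

theorem trace_dm_ricM (s : ι) : (F.dm s F.ricM).trace = 0 := by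
  rw [trace_dm, h.scal, Derivation.map_one_eq_zero]

/-- Tracing `dm_ricM_sub` gives div Ric − dS on the left and −Ric(∇f) = 0 on the right; dS = 0. -/
theorem div_ricM (k : ι) : ∑ i, F.dm i F.ricM i k = 0 := by
  have h1 : ∑ i, (F.dm i F.ricM k i - F.dm k F.ricM i i) = 0 := by
    have e : (F.ricM *ᵥ F.gr f) k = 0 := by rw [h.ricM_mulVec_gr]; rfl
    simp only [h.dm_ricM_sub]
    rw [Finset.sum_comm, ← neg_eq_zero, ← e, ← Finset.sum_neg_distrib]
    refine Finset.sum_congr rfl fun l _ ↦ ?_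
    change _ = F.ricM k l * F.gr f l
    rw [← Finset.sum_mul, F.sum_R_eq_neg_ricM]; ring
  have h2 := h.trace_dm_ricM k
  rw [trace] at h2
  simp only [diag] at h2
  rw [Finset.sum_sub_distrib, h2, sub_zero] at h1
  rw [← h1]
  exact Finset.sum_congr rfl fun i _ ↦ F.dm_ricM_symm i i k

/-- The Leibniz rule applied to Ric(∇f) = 0. -/
theorem dm_ricM_gr (i j : ι) : ∑ k, F.dm i F.ricM j k * F.gr f k
    = ∑ k, F.ricM j k * F.ricM i k - algebraMap ℝ A (1 / 2) * F.ricM j i := by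
  have h1 := congrFun (F.dm_mulVec i F.ricM (F.gr f)) j
  rw [h.ricM_mulVec_gr, dv_zero] at h1
  simp only [mulVec, dotProduct, Pi.sub_apply, h.dv_gr, Pi.zero_apply, mul_sub, mul_ite, mul_zero,
    Finset.sum_sub_distrib, Finset.sum_ite_eq, Finset.mem_univ, if_true] at h1
  linear_combination h1

/-- Contracting `dm_ricM_gr` over its two free indices gives (div Ric)(∇f) = |Ric|² − S/2, and the
left side vanishes. -/
theorem trace_sq : (F.ricM * F.ricM).trace = algebraMap ℝ A (1 / 2) := by
  have h1 : ∑ i, ∑ k, F.dm i F.ricM i k * F.gr f k = 0 := by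
    rw [Finset.sum_comm]
    simp only [← Finset.sum_mul, h.div_ricM, zero_mul, Finset.sum_const_zero]
  have h2 := h.scal
  simp only [trace, diag, mul_apply] at h2 ⊢
  simp only [h.dm_ricM_gr, Finset.sum_sub_distrib, ← Finset.mul_sum, h2] at h1
  simp only [F.ricM_symm _ _] at h1 ⊢
  rw [← sub_eq_zero]
  rw [mul_one] at h1
  rw [← h1]

/-- The drifted Laplacian of the Ricci tensor. -/
theorem drift_lapM_ricM (j k : ι) :
    F.lapM F.ricM j k - ∑ l, F.gr f l * F.dm l F.ricM j k
      = F.ricM j k - 2 * ∑ i, ∑ l, F.R i j k l * F.ricM i l := by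
  -- the divergence of `∇_i Ric_jk - ∇_j Ric_ik = R_ijkl f_l`
  have e1 : ∀ s i j k, F.d3 s (fun a ↦ F.dm a F.ricM) i j k
      - F.d3 s (fun a ↦ F.dm a F.ricM) j i k
      = ∑ l, F.d4 s F.R i j k l * F.gr f l
        + ∑ l, F.R i j k l * F.dv s (F.gr f) l := fun s i j k ↦ by
    rw [← d3_mulVec]
    have hC : (fun i ↦ Matrix.of fun j ↦ F.R i j *ᵥ F.gr f)
        = fun i ↦ (F.dm i F.ricM - Matrix.of fun j ↦ F.dm j F.ricM i) := by
      ext i j k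
      exact (h.dm_ricM_sub i j k).symm
    have hl : F.d3 s (fun a ↦ F.dm a F.ricM) i j k = F.D s (F.dm i F.ricM j k)
      - ∑ m, F.Γ s k m * F.dm i F.ricM j m - ∑ m, F.Γ s j m * F.dm i F.ricM m k
      - ∑ m, F.Γ s i m * F.dm m F.ricM j k := rfl
    have hl' : F.d3 s (fun a ↦ F.dm a F.ricM) j i k = F.D s (F.dm j F.ricM i k)
      - ∑ m, F.Γ s k m * F.dm j F.ricM i m - ∑ m, F.Γ s i m * F.dm j F.ricM m k
      - ∑ m, F.Γ s j m * F.dm m F.ricM i k := rfl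
    rw [hC, hl, hl']
    simp only [d3, dm_apply _ _ (_ - _), Matrix.sub_apply, Matrix.of_apply, map_sub, mul_sub,
      Finset.sum_sub_distrib]
    ring
  -- After commuting ∇_i and ∇_j what is left is ∇_j of div Ric, which is zero, and curvature terms.
  have e2 : ∑ i, F.d3 i (fun a ↦ F.dm a F.ricM) j i k
      = -∑ i, ∑ m, F.R i j i m * F.ricM m k - ∑ i, ∑ m, F.R i j k m * F.ricM i m := by
    have hd : ∑ i, F.d3 j (fun a ↦ F.dm a F.ricM) i i k = 0 := by
      rw [sum_d3]
      simp only [h.div_ricM]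
      exact congrFun (F.dv_zero j) k
    rw [← sub_zero (∑ i, F.d3 i (fun a ↦ F.dm a F.ricM) j i k), ← hd, ← Finset.sum_sub_distrib]
    simp only [F.d3_comm, Finset.sum_sub_distrib, Finset.sum_neg_distrib]
  have e3 : ∑ i, ∑ m, F.R i j i m * F.ricM m k = -∑ m, F.ricM j m * F.ricM k m := by
    rw [Finset.sum_comm, ← Finset.sum_neg_distrib]
    refine Finset.sum_congr rfl fun m _ ↦ ?_
    rw [← Finset.sum_mul, F.sum_R_eq_neg_ricM, F.ricM_symm k m]; ring
  -- The contracted second Bianchi identity produces ∇_{∇f} Ric, the drift term, and a term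
  -- evaluated by `dm_ricM_gr`.
  have e4 : ∑ i, ∑ l, F.d4 i F.R i j k l * F.gr f l
      = ∑ l, F.dm l F.ricM k j * F.gr f l - ∑ l, F.dm k F.ricM j l * F.gr f l := by
    rw [Finset.sum_comm, ← Finset.sum_sub_distrib]
    refine Finset.sum_congr rfl fun l _ ↦ ?_
    rw [← Finset.sum_mul, F.div_R, F.dm_ricM_symm k l j]; ring
  have e5 : ∑ i, ∑ l, F.R i j k l * F.dv i (F.gr f) l
      = algebraMap ℝ A (1 / 2) * F.ricM j k - ∑ i, ∑ l, F.R i j k l * F.ricM i l := by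
    simp only [h.dv_gr, mul_sub, mul_ite, mul_zero, Finset.sum_sub_distrib, Finset.sum_ite_eq,
      Finset.mem_univ, if_true]
    rw [← Finset.sum_mul, ricM_apply]; ring
  have e6 : ∑ i, F.d3 i (fun a ↦ F.dm a F.ricM) i j k
      - ∑ i, F.d3 i (fun a ↦ F.dm a F.ricM) j i k
      = ∑ i, ∑ l, F.d4 i F.R i j k l * F.gr f l
        + ∑ i, ∑ l, F.R i j k l * F.dv i (F.gr f) l := by
    rw [← Finset.sum_sub_distrib, ← Finset.sum_add_distrib]
    exact Finset.sum_congr rfl fun i _ ↦ e1 i i j k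
  have e7 : ∑ l, F.gr f l * F.dm l F.ricM j k = ∑ l, F.dm l F.ricM k j * F.gr f l :=
    Finset.sum_congr rfl fun l _ ↦ by rw [F.dm_ricM_symm l j k]; ring
  rw [lapM_apply, e7]
  -- The Ric² of `e3` cancels the Ric² of `dm_ricM_gr`; the halves of Ric from `e5` and `dm_ricM_gr`
  -- add up to Ric, and Rm*Ric occurs once in `e2` and once in `e5`.
  linear_combination e6 + e2 - e3 + e4 + e5 - h.dm_ricM_gr k j
    + F.ricM j k * (half_add_half (A := A))

end IsSoliton

/-! ### Drifted Laplacians of tr Ric² and tr Ric³. -/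

/-- The drifted Laplacian of a function. -/
def drift (f a : A) : A := F.lap a - ∑ l, F.gr f l * F.D l a

/-- The drifted rough Laplacian of a tensor of rank two. -/
def driftM (f : A) (T : Matrix ι ι A) : Matrix ι ι A := F.lapM T - ∑ l, F.gr f l • F.dm l T

omit [DecidableEq ι] in
theorem trace_driftM (f : A) (T : Matrix ι ι A) :
    (F.driftM f T).trace = F.drift f T.trace := by
  simp only [driftM, drift, trace_sub, trace_lapM, trace_sum, trace_smul, trace_dm, smul_eq_mul]

theorem driftM_mul (f : A) (S T : Matrix ι ι A) :
    F.driftM f (S * T)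
      = F.driftM f S * T + S * F.driftM f T + (2 : A) • ∑ i, F.dm i S * F.dm i T := by
  simp only [driftM, lapM_mul, dm_mul, smul_add, Finset.sum_add_distrib, sub_mul, mul_sub,
    Finset.sum_mul, Finset.mul_sum, smul_mul_assoc, mul_smul_comm]
  abel

/-- The action of the curvature on the Ricci tensor. -/
def rmRic : Matrix ι ι A := fun j k ↦ ∑ i, ∑ l, F.R i j k l * F.ricM i l

/-- By cyclicity of the trace the three second-order terms agree, and so do the three cross terms,
each of which carries a factor 2. -/
theorem trace_driftM_cube (f : A) (T : Matrix ι ι A) :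
    F.drift f (T * T * T).trace
      = 3 * (T * T * F.driftM f T).trace + 6 * ∑ s, (F.dm s T * F.dm s T * T).trace := by
  rw [← trace_driftM, driftM_mul, driftM_mul]
  have h1 : (F.driftM f T * T * T).trace = (T * T * F.driftM f T).trace := by
    rw [mul_assoc, trace_mul_comm]
  have h2 : (T * F.driftM f T * T).trace = (T * T * F.driftM f T).trace := by
    rw [trace_mul_cycle]
  have h3 : ∀ i, (F.dm i T * T * F.dm i T).trace = (F.dm i T * F.dm i T * T).trace := fun i ↦ by
    rw [trace_mul_cycle]
  have h4 : ∀ i, (T * F.dm i T * F.dm i T).trace = (F.dm i T * F.dm i T * T).trace := fun i ↦ by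
    rw [mul_assoc, trace_mul_comm]
  simp only [dm_mul, add_mul, Finset.sum_add_distrib, smul_mul_assoc, Finset.sum_mul, smul_add,
    trace_add, trace_smul, trace_sum, h1, h2, h3, h4, smul_eq_mul]
  ring

namespace IsSoliton

variable {F} {f : A} (h : F.IsSoliton f)
include h

theorem driftM_ricM : F.driftM f F.ricM = F.ricM - (2 : A) • F.rmRic := by
  ext j k
  have := h.drift_lapM_ricM j k
  simp only [driftM, Matrix.sub_apply, Matrix.sum_apply, Matrix.smul_apply, smul_eq_mul]
  exact this

/-- The product rule for Δ_f tr Ric², which is zero because tr Ric² is the constant 1/2. -/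
theorem norm_dm_ricM : ∑ s, (F.dm s F.ricM * F.dm s F.ricM).trace
    = 2 * (F.ricM * F.rmRic).trace - algebraMap ℝ A (1 / 2) := by
  have h1 := F.trace_driftM f (F.ricM * F.ricM)
  rw [h.trace_sq, drift, lap, driftM_mul, h.driftM_ricM] at h1
  simp only [Derivation.map_algebraMap, map_zero, mul_zero, Finset.sum_const_zero, sub_zero,
    trace_add, sub_mul, mul_sub, trace_sub, trace_smul, smul_mul_assoc, mul_smul_comm, h.trace_sq,
    trace_mul_comm F.rmRic, trace_sum, smul_eq_mul] at h1
  rw [← sub_eq_zero]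
  refine eq_zero_of_add_self ?_
  linear_combination h1

theorem drift_trace_cube : F.drift f (F.ricM * F.ricM * F.ricM).trace
    = 3 * (F.ricM * F.ricM * F.ricM).trace - 6 * (F.ricM * F.ricM * F.rmRic).trace
      + 6 * ∑ s, (F.dm s F.ricM * F.dm s F.ricM * F.ricM).trace := by
  rw [trace_driftM_cube, h.driftM_ricM]
  simp only [mul_sub, trace_sub, mul_smul_comm, trace_smul, smul_eq_mul]
  ring

end IsSoliton

end FrameAlgebra

/-! ### Algebra of the Ricci eigenvalues in dimension four. -/

/-- Only indices 1, 2, 3 matter. Symmetrizing turns l_i l_j² into l_i l_j (l_i + l_j) = l_i l_j (1 −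
l_k), with k the third index, so the cubic sum over i < j is the quadratic one minus l_1 l_2 l_3 ∑
K_ij = l_1 l_2 l_3 / 2. Newton's identity with e₁ = 1 and e₂ = 1/4 gives ∑ l³ − 1/4 = 3 l_1 l_2 l_3.
-/
theorem curvature_sum_identity_of_zero {K : Fin 4 → Fin 4 → ℝ} {l : Fin 4 → ℝ}
    (hK : ∀ i j, K i j = K j i) (hd : ∀ i, K i i = 0) (hl : ∀ j, ∑ i, K i j = l j)
    (h0 : l 0 = 0) (h1 : ∑ i, l i = 1) (h2 : ∑ i, l i ^ 2 = 1 / 2) :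
    -6 * ∑ i, ∑ j, K i j * l i * l j ^ 2
      = ∑ i, l i ^ 3 - 1 / 4 - 3 * ∑ i, ∑ j, K i j * l i * l j := by
  have e0 := hl 0
  have e1 := hl 1
  have e2 := hl 2
  have e3 := hl 3
  simp only [Fin.sum_univ_four, hd, h0, hK 1 0, hK 2 0, hK 3 0, hK 2 1, hK 3 1, hK 3 2] at *
  -- All six K_ij add up to half of ∑ l, and the three in row 0 add up to `l 0` = 0.
  have hs : K 1 2 + K 1 3 + K 2 3 = 1 / 2 := by linarith
  obtain hl3 : l 3 = 1 - l 1 - l 2 := by linarith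
  obtain hk : K 2 3 = 1 / 2 - K 1 2 - K 1 3 := by linarith
  rw [hl3] at h2 ⊢
  rw [hk]
  linear_combination -(3 / 2) * h2

theorem curvature_sum_identity {K : Fin 4 → Fin 4 → ℝ} {l : Fin 4 → ℝ}
    (hK : ∀ i j, K i j = K j i) (hd : ∀ i, K i i = 0) (hl : ∀ j, ∑ i, K i j = l j)
    (h0 : ∃ p, l p = 0) (h1 : ∑ i, l i = 1) (h2 : ∑ i, l i ^ 2 = 1 / 2) :
    -6 * ∑ i, ∑ j, K i j * l i * l j ^ 2
      = ∑ i, l i ^ 3 - 1 / 4 - 3 * ∑ i, ∑ j, K i j * l i * l j := by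
  obtain ⟨p, hp⟩ := h0
  set σ := Equiv.swap 0 p
  have := curvature_sum_identity_of_zero (K := fun i j ↦ K (σ i) (σ j)) (l := l ∘ σ)
    (fun _ _ ↦ hK _ _) (fun _ ↦ hd _) (fun j ↦ by rw [Equiv.sum_comp σ (K · (σ j)), hl]; rfl)
    (by simpa [σ] using hp) (by rw [← h1]; exact Equiv.sum_comp σ l)
    (by rw [← h2]; exact Equiv.sum_comp σ (l · ^ 2))
  have e : ∀ g : Fin 4 → Fin 4 → ℝ, ∑ i, ∑ j, g (σ i) (σ j) = ∑ i, ∑ j, g i j := fun g ↦ by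
    rw [← Equiv.sum_comp σ (fun i ↦ ∑ j, g i j)]
    exact Finset.sum_congr rfl fun i _ ↦ Equiv.sum_comp σ (g (σ i))
  simp only [Function.comp_apply] at this
  rwa [e (fun i j ↦ K i j * l i * l j ^ 2), e (fun i j ↦ K i j * l i * l j),
    Equiv.sum_comp σ (l · ^ 3)] at this

/-- Discard the zero entry. If one of the remaining three were negative, the other two would have
sum above 1, hence square sum above 1/2. -/
theorem nonneg_of_sum_sq {l : Fin 4 → ℝ} (h0 : ∃ p, l p = 0) (h1 : ∑ i, l i = 1)
    (h2 : ∑ i, l i ^ 2 = 1 / 2) (i : Fin 4) : 0 ≤ l i := by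
  have key : ∀ a b c : ℝ, a + b + c = 1 → a ^ 2 + b ^ 2 + c ^ 2 = 1 / 2 → 0 ≤ a := by
    intro a b c h1 h2
    by_contra! ha
    have hc : c = 1 - a - b := by linarith
    subst hc
    nlinarith [sq_nonneg (b - (1 - a - b)), sq_nonneg a]
  obtain ⟨p, hp⟩ := h0
  simp only [Fin.sum_univ_four] at h1 h2
  fin_cases p <;> simp only [Fin.zero_eta, Fin.mk_one, Fin.reduceFinMk, Fin.isValue] at hp <;>
    rw [hp] at h1 h2 <;> fin_cases i <;>
    simp only [Fin.zero_eta, Fin.mk_one, Fin.reduceFinMk, Fin.isValue] <;>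
    first
    | exact hp.ge
    | exact key _ (l 1) (l 2) (by linarith) (by linarith)
    | exact key _ (l 1) (l 3) (by linarith) (by linarith)
    | exact key _ (l 2) (l 3) (by linarith) (by linarith)
    | exact key _ (l 0) (l 1) (by linarith) (by linarith)
    | exact key _ (l 0) (l 2) (by linarith) (by linarith)
    | exact key _ (l 0) (l 3) (by linarith) (by linarith)

/-! ### Vector fields in components, and naturality of the frame calculus. -/

namespace FrameAlgebra

open Matrix

variable {A ι : Type*} [CommRing A] [Algebra ℝ A] [Fintype ι] (F : FrameAlgebra A ι)

/-- The components of the curvature of vector fields. -/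
theorem curvature_eq (X Y Z : ι → A) :
    ∑ j, Y j • F.dv j (∑ i, X i • F.dv i Z) - ∑ i, X i • F.dv i (∑ j, Y j • F.dv j Z)
      + ∑ m, (∑ i, X i * F.D i (Y m) - ∑ i, Y i * F.D i (X m)
        + ∑ i, ∑ j, X i * Y j * F.c i j m) • F.dv m Z
      = ∑ i, ∑ j, (X i * Y j) • (F.R i j *ᵥ Z) := by
  have h1 : ∀ S T : ι → A, ∑ j, S j • F.dv j (∑ i, T i • F.dv i Z)
      = ∑ m, (∑ i, S i * F.D i (T m)) • F.dv m Z
        + ∑ j, ∑ i, (S j * T i) • F.dv j (F.dv i Z) := fun S T ↦ by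
    simp only [dv_sum, dv_smul, Finset.sum_add_distrib, smul_add, Finset.smul_sum, smul_smul,
      Finset.sum_smul]
    congr 1
    exact Finset.sum_comm
  have h2 : ∑ m, (∑ i, ∑ j, X i * Y j * F.c i j m) • F.dv m Z
      = ∑ i, ∑ j, (X i * Y j) • ∑ m, F.c i j m • F.dv m Z := by
    simp only [Finset.sum_smul, Finset.smul_sum, smul_smul]
    rw [Finset.sum_comm]
    exact Finset.sum_congr rfl fun i _ ↦ Finset.sum_comm
  have h3 : ∑ i, ∑ j, (X i * Y j) • (F.R i j *ᵥ Z)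
      = ∑ i, ∑ j, (X i * Y j) • ∑ m, F.c i j m • F.dv m Z
        - ∑ i, ∑ j, (X i * Y j) • F.dv i (F.dv j Z)
        + ∑ i, ∑ j, (X i * Y j) • F.dv j (F.dv i Z) := by
    simp only [← Finset.sum_sub_distrib, ← Finset.sum_add_distrib, ← smul_sub, ← smul_add]
    refine Finset.sum_congr rfl fun i _ ↦ Finset.sum_congr rfl fun j _ ↦ ?_
    congr 1
    have := F.dv_comm i j Z
    linear_combination (exp := 1) this
  have h4 : ∑ j, ∑ i, (Y j * X i) • F.dv j (F.dv i Z)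
      = ∑ i, ∑ j, (X i * Y j) • F.dv j (F.dv i Z) := by
    rw [Finset.sum_comm]
    exact Finset.sum_congr rfl fun i _ ↦ Finset.sum_congr rfl fun j _ ↦ by rw [mul_comm]
  rw [h1, h1, h3, h4]
  simp only [add_smul, sub_smul, Finset.sum_add_distrib, Finset.sum_sub_distrib, h2]
  abel

theorem D_dotProduct (s : ι) (X Y : ι → A) :
    F.D s (X ⬝ᵥ Y) = F.dv s X ⬝ᵥ Y + X ⬝ᵥ F.dv s Y := by
  have h := F.sum_Γ_contract s (fun m i ↦ X m * Y i)
  simp only [dotProduct, dv, map_sum, Derivation.leibniz, smul_eq_mul, sub_mul, mul_sub,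
    Finset.sum_sub_distrib, Finset.sum_add_distrib, Finset.sum_mul, Finset.mul_sum]
  simp only [mul_assoc, mul_left_comm (X _)] at h ⊢
  simp only [mul_comm (F.D s (X _))]
  linear_combination h

theorem D_bilinear (s : ι) (T : Matrix ι ι A) (X Y : ι → A) :
    F.D s (X ⬝ᵥ T *ᵥ Y) - F.dv s X ⬝ᵥ T *ᵥ Y - X ⬝ᵥ T *ᵥ F.dv s Y = X ⬝ᵥ F.dm s T *ᵥ Y := by
  rw [D_dotProduct, dm_mulVec, dotProduct_sub]; ring

end FrameAlgebra

namespace FrameAlgebra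

open Matrix

variable {A B ι : Type*} [CommRing A] [Algebra ℝ A] [CommRing B] [Algebra ℝ B] [Fintype ι]
  {F : FrameAlgebra A ι} {G : FrameAlgebra B ι} {φ : A →ₐ[ℝ] B}

/-- Curvature is built from `D` and `Γ` by ring operations, so it is natural under homomorphisms
intertwining them; this serves for restriction to smaller open sets. -/
theorem map_R (hD : ∀ i a, G.D i (φ a) = φ (F.D i a)) (hΓ : ∀ i j k, G.Γ i j k = φ (F.Γ i j k))
    (i j k l : ι) : G.R i j k l = φ (F.R i j k l) := by
  simp only [R, c, hΓ, hD, map_add, map_sub, map_sum, map_mul]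

theorem map_ricM (hD : ∀ i a, G.D i (φ a) = φ (F.D i a))
    (hΓ : ∀ i j k, G.Γ i j k = φ (F.Γ i j k)) (i j : ι) : G.ricM i j = φ (F.ricM i j) := by
  simp only [ricM, map_R hD hΓ, map_sum]

theorem map_dm_ricM (hD : ∀ i a, G.D i (φ a) = φ (F.D i a))
    (hΓ : ∀ i j k, G.Γ i j k = φ (F.Γ i j k)) (s i j : ι) :
    G.dm s G.ricM i j = φ (F.dm s F.ricM i j) := by
  simp only [dm, dv, map_ricM hD hΓ, hD, hΓ, map_sub, map_sum, map_mul]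

end FrameAlgebra

/-! ### Gram determinants and orthonormal changes of basis. -/

theorem linearIndependent_of_det_ne_zero {V κ : Type*} [NormedAddCommGroup V]
    [InnerProductSpace ℝ V] [Fintype κ] [DecidableEq κ] {v : κ → V}
    (h : (Matrix.of fun i j ↦ inner ℝ (v i) (v j)).det ≠ 0) : LinearIndependent ℝ v := by
  rw [Fintype.linearIndependent_iff]
  intro c hc
  refine congrFun (Matrix.eq_zero_of_mulVec_eq_zero h ?_)
  ext i
  have := congrArg (inner ℝ (v i)) hc
  simp only [inner_sum, inner_smul_right, inner_zero_right] at this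
  simpa only [Matrix.mulVec, dotProduct, Matrix.of_apply, mul_comm (c _), Pi.zero_apply] using this

section Conjugation

open Matrix

variable {κ ι : Type*} [Fintype κ] [Fintype ι] [DecidableEq ι] {Q : Matrix κ ι ℝ}

theorem Matrix.trace_mul_mul {A B C : Matrix κ κ ℝ} :
    (A * B * C).trace = ∑ i, ∑ j, ∑ k, A i j * B j k * C k i := by
  simp only [trace, diag, mul_apply, Finset.sum_mul]
  exact Finset.sum_congr rfl fun i _ ↦ Finset.sum_comm

theorem Matrix.conj_mul_conj (hQ : Qᵀ * Q = 1) (A B : Matrix ι ι ℝ) :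
    Q * A * Qᵀ * (Q * B * Qᵀ) = Q * (A * B) * Qᵀ := by
  have : Q * A * Qᵀ * (Q * B * Qᵀ) = Q * A * (Qᵀ * Q) * B * Qᵀ := by
    simp only [Matrix.mul_assoc]
  rw [this, hQ, Matrix.mul_one]
  simp only [Matrix.mul_assoc]

theorem Matrix.trace_mul_mul_transpose (hQ : Qᵀ * Q = 1) (A : Matrix ι ι ℝ) :
    (Q * A * Qᵀ).trace = A.trace := by
  rw [trace_mul_comm, ← Matrix.mul_assoc, hQ, Matrix.one_mul]

theorem Matrix.sum_contract (hQ : Qᵀ * Q = 1) (β : ι → ι → ℝ) :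
    ∑ s, ∑ r, ∑ t, Q s r * (Q s t * β r t) = ∑ r, β r r := by
  have h : ∀ r t, ∑ s, Q s r * Q s t = if r = t then 1 else 0 := fun r t ↦
    congrFun (congrFun hQ r) t
  refine Finset.sum_comm.trans (Finset.sum_congr rfl fun r _ ↦ Finset.sum_comm.trans ?_)
  simp only [← mul_assoc, ← Finset.sum_mul, h, ite_mul, one_mul, zero_mul, Finset.sum_ite_eq,
    Finset.mem_univ, if_true]

/-- Basis independence of the full contraction. `Q` is rectangular on paper, its index types being
unrelated; QᵀQ = 1 is all that the cancellation needs. -/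
theorem Matrix.sum_trace_mul_conj (hQ : Qᵀ * Q = 1) (N : ι → Matrix ι ι ℝ) (T : Matrix ι ι ℝ) :
    ∑ s, ((Q * (∑ r, Q s r • N r) * Qᵀ) * (Q * (∑ r, Q s r • N r) * Qᵀ) * (Q * T * Qᵀ)).trace
      = ∑ r, (N r * N r * T).trace := by
  simp only [conj_mul_conj hQ, trace_mul_mul_transpose hQ]
  rw [← Matrix.sum_contract hQ fun r t ↦ (N t * N r * T).trace]
  simp only [Matrix.sum_mul, Matrix.mul_sum, Matrix.smul_mul, Matrix.mul_smul, trace_sum,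
    trace_smul, smul_eq_mul, Finset.smul_sum]

theorem Matrix.sum_trace_mul_self_conj (hQ : Qᵀ * Q = 1) (N : ι → Matrix ι ι ℝ) :
    ∑ s, ((Q * (∑ r, Q s r • N r) * Qᵀ) * (Q * (∑ r, Q s r • N r) * Qᵀ)).trace
      = ∑ r, (N r * N r).trace := by
  have h := sum_trace_mul_conj hQ N 1
  simp only [conj_mul_conj hQ, trace_mul_mul_transpose hQ] at h ⊢
  simpa only [Matrix.mul_one] using h

omit [Fintype κ] [DecidableEq ι] in
theorem Matrix.mul_mul_transpose_apply (A : Matrix ι ι ℝ) (p q : κ) :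
    (Q * A * Qᵀ) p q = ∑ i, ∑ j, Q p i * A i j * Q q j := by
  simp only [mul_apply, transpose_apply, Finset.sum_mul]
  exact Finset.sum_comm

end Conjugation

/-! ### Smooth functions on open sets, and Lie brackets. -/

open Bundle VectorField
open scoped Manifold ContDiff Topology

noncomputable section

set_option linter.unusedSectionVars false

variable {E : Type*} [NormedAddCommGroup E] [NormedSpace ℝ E]
  {H : Type*} [TopologicalSpace H] {I : ModelWithCorners ℝ E H}
  {M : Type*} [TopologicalSpace M] [ChartedSpace H M]

section SmoothFunctions

/-- Extension by zero of a function defined on an open set. -/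
def extendZero (U : TopologicalSpace.Opens M) (a : U → ℝ) (y : M) : ℝ :=
  open scoped Classical in if h : y ∈ U then a ⟨y, h⟩ else 0

theorem extendZero_coe {U : TopologicalSpace.Opens M} (a : U → ℝ) (y : U) :
    extendZero U a y = a y := by
  simp [extendZero]

theorem extendZero_eventuallyEq {U : TopologicalSpace.Opens M} {a : U → ℝ} {u : M → ℝ}
    (h : ∀ y : U, a y = u y) (y : U) : extendZero U a =ᶠ[𝓝 (y : M)] u := by
  filter_upwards [U.isOpen.mem_nhds y.2] with z hz
  rw [← h ⟨z, hz⟩]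
  exact extendZero_coe a ⟨z, hz⟩

variable (I) in
/-- The algebra of smooth functions on an open set. -/
def smoothFun (U : TopologicalSpace.Opens M) : Subalgebra ℝ (U → ℝ) where
  -- The elements live on `U`, so that equality in the algebra is equality on `U`; smoothness is
  -- tested on the extension by zero because derivatives are taken on `M`.
  carrier := {a | ∀ y : U, CMDiffAt ∞ (extendZero U a) (y : M)}
  mul_mem' {a b} ha hb y := ((ha y).mul (hb y)).congr_of_eventuallyEq
    (extendZero_eventuallyEq (fun z ↦ by simp [extendZero_coe]) y)
  add_mem' {a b} ha hb y := ((ha y).add (hb y)).congr_of_eventuallyEq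
    (extendZero_eventuallyEq (fun z ↦ by simp [extendZero_coe]) y)
  algebraMap_mem' r y := (contMDiffAt_const (c := r)).congr_of_eventuallyEq
    (extendZero_eventuallyEq (fun z ↦ by simp) y)

/-- The restriction of a smooth function. -/
def smoothFun.mk {U : TopologicalSpace.Opens M} (u : M → ℝ) (hu : ∀ y ∈ U, CMDiffAt ∞ u y) :
    smoothFun I U :=
  ⟨fun y ↦ u y, fun y ↦ (hu y y.2).congr_of_eventuallyEq
    (extendZero_eventuallyEq (fun _ ↦ rfl) y)⟩

theorem smoothFun.ext' {U : TopologicalSpace.Opens M} {a b : smoothFun I U}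
    (h : ∀ y : U, a.1 y = b.1 y) : a = b :=
  Subtype.ext (funext h)

variable (I) in
/-- Evaluation at a point. -/
def smoothFun.eval {U : TopologicalSpace.Opens M} (y : U) : smoothFun I U →ₐ[ℝ] ℝ :=
  (Pi.evalAlgHom ℝ (fun _ : U ↦ ℝ) y).comp (smoothFun I U).val

theorem smoothFun.mdifferentiableAt {U : TopologicalSpace.Opens M} (a : smoothFun I U) (y : U) :
    MDiffAt (extendZero U a.1) (y : M) :=
  (a.2 y).mdifferentiableAt (by simp)

end SmoothFunctions

theorem mvfderiv_congr {u v : M → ℝ} {y : M} (h : u =ᶠ[𝓝 y] v) :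
    mvfderiv I u y = mvfderiv I v y := by
  unfold mvfderiv
  rw [h.mfderiv_eq, h.eq_of_nhds]

theorem mvfderiv_sum {κ : Type*} (s : Finset κ) (u : κ → M → ℝ) {y : M}
    (h : ∀ k, CMDiffAt ∞ (u k) y) (v : TangentSpace I y) :
    mvfderiv I (fun z ↦ ∑ k ∈ s, u k z) y v = ∑ k ∈ s, mvfderiv I (u k) y v := by
  classical
  induction s using Finset.induction_on with
  | empty => simp [mvfderiv_const]
  | insert a s ha ih =>
    simp only [Finset.sum_insert ha]
    rw [← ih, mvfderiv_fun_add ((h a).mdifferentiableAt (by simp))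
      ((contMDiffAt_finsetSum fun k _ ↦ h k).mdifferentiableAt (by simp))]
    rfl

theorem mvfderiv_mul_apply {u w : M → ℝ} {y : M} (hu : MDiffAt u y) (hw : MDiffAt w y)
    (v : TangentSpace I y) : mvfderiv I (fun z ↦ u z * w z) y v
      = u y * mvfderiv I w y v + w y * mvfderiv I u y v := by
  rw [mvfderiv_fun_mul hu hw]
  rfl

variable [IsManifold I ∞ M]

variable (I M) in
theorem isManifold_minSmoothness (k : ℕ) : IsManifold I (minSmoothness ℝ k) M := by
  rw [minSmoothness_of_isRCLikeNormedField]
  exact IsManifold.of_le (n := ∞) (mod_cast le_top)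

variable [FiniteDimensional ℝ E]

theorem contMDiffAt_mlieBracket {X Y : ∀ x : M, TangentSpace I x} {y : M}
    (hX : CMDiffAt ∞ (T% X) y) (hY : CMDiffAt ∞ (T% Y) y) :
    CMDiffAt ∞ (T% (mlieBracket I X Y)) y := by
  have : IsManifold I (((⊤ : ℕ∞) : WithTop ℕ∞) + 1) M := inferInstanceAs (IsManifold I ∞ M)
  have : IsManifold I (minSmoothness ℝ 2) M := isManifold_minSmoothness I M 2
  have : CompleteSpace E := FiniteDimensional.complete ℝ E
  exact ContMDiffAt.mlieBracket_vectorField (m := ⊤) (n := ⊤) hX hY (by simp)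

theorem jacobi_mlieBracket {X Y Z : ∀ x : M, TangentSpace I x} {y : M}
    (hX : CMDiffAt ∞ (T% X) y) (hY : CMDiffAt ∞ (T% Y) y) (hZ : CMDiffAt ∞ (T% Z) y) :
    mlieBracket I X (mlieBracket I Y Z) y =
      mlieBracket I (mlieBracket I X Y) Z y + mlieBracket I Y (mlieBracket I X Z) y := by
  have : IsManifold I (minSmoothness ℝ 3) M := isManifold_minSmoothness I M 3
  have : CompleteSpace E := FiniteDimensional.complete ℝ E
  have h2 : minSmoothness ℝ 2 ≤ ∞ := by
    rw [minSmoothness_of_isRCLikeNormedField]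
    exact WithTop.coe_le_coe.2 (le_top (a := (2 : ℕ∞)))
  exact leibniz_identity_mlieBracket_apply (hX.of_le h2) (hY.of_le h2) (hZ.of_le h2)

theorem mlieBracket_sum_smul_right {κ : Type*} (s : Finset κ) (X : ∀ x : M, TangentSpace I x)
    (e : κ → ∀ x : M, TangentSpace I x) (u : κ → M → ℝ) {y : M}
    (he : ∀ k, CMDiffAt ∞ (T% (e k)) y) (hu : ∀ k, CMDiffAt ∞ (u k) y) :
    mlieBracket I X (fun z ↦ ∑ k ∈ s, u k z • e k z) y
      = ∑ k ∈ s, (mvfderiv I (u k) y (X y) • e k y + u k y • mlieBracket I X (e k) y) := by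
  classical
  have : IsManifold I (minSmoothness ℝ 2) M := isManifold_minSmoothness I M 2
  have : CompleteSpace E := FiniteDimensional.complete ℝ E
  have he' := fun k ↦ (he k).mdifferentiableAt (by simp)
  have hu' := fun k ↦ (hu k).mdifferentiableAt (by simp)
  induction s using Finset.induction_on with
  | empty =>
    simp only [Finset.sum_empty]
    exact congrFun (mlieBracket_zero_right (W := X)) y
  | insert a s ha ih =>
    simp only [Finset.sum_insert ha]
    rw [← ih, ← mlieBracket_smul_right (hu' a) (he' a), ← mlieBracket_add_right]
    · rfl
    · exact (hu' a).smul_section (he' a)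
    · exact MDifferentiableAt.sum_section fun k _ ↦ (hu' k).smul_section (he' k)

variable [RiemannianBundle (fun x : M ↦ TangentSpace I x)]

/-! ### Smooth orthonormal frames and their connection coefficients. -/

variable (I) in
/-- An orthonormal frame of smooth vector fields on an open set. -/
structure OrthoFrame (M : Type*) [TopologicalSpace M] [ChartedSpace H M] [IsManifold I ∞ M]
    [RiemannianBundle (fun x : M ↦ TangentSpace I x)] (ι : Type*) [Fintype ι] where
  U : TopologicalSpace.Opens M
  e : ι → ∀ x : M, TangentSpace I x
  smooth : ∀ i, ∀ y ∈ U, CMDiffAt ∞ (T% (e i)) y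
  orthonormal : ∀ y ∈ U, Orthonormal ℝ (fun i ↦ e i y)
  sum_inner : ∀ y ∈ U, ∀ v : TangentSpace I y, ∑ i, inner ℝ (e i y) v • e i y = v

namespace OrthoFrame

variable [IsContMDiffRiemannianBundle I ∞ E (fun x : M ↦ TangentSpace I x)]
  {ι : Type*} [Fintype ι] [DecidableEq ι] (F : OrthoFrame I M ι)

/-- The components of a vector field. -/
def comp (Y : ∀ x : M, TangentSpace I x) (i : ι) (y : M) : ℝ := inner ℝ (F.e i y) (Y y)

/-- The structure functions of the frame. -/
def cf (i j k : ι) (y : M) : ℝ := inner ℝ (mlieBracket I (F.e i) (F.e j) y) (F.e k y)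

/-- The connection coefficients of the frame. -/
def Γf (i j k : ι) (y : M) : ℝ := (1 / 2) * (F.cf i j k y - F.cf i k j y - F.cf j k i y)

theorem inner_e {y : M} (hy : y ∈ F.U) (i j : ι) :
    inner ℝ (F.e i y) (F.e j y) = if i = j then 1 else 0 :=
  orthonormal_iff_ite.1 (F.orthonormal y hy) i j

theorem contMDiffAt_comp {Y : ∀ x : M, TangentSpace I x} {y : M} (hy : y ∈ F.U)
    (hY : CMDiffAt ∞ (T% Y) y) (i : ι) : CMDiffAt ∞ (F.comp Y i) y :=
  ContMDiffAt.inner_bundle (F := E) (E := fun x : M ↦ TangentSpace I x) (F.smooth i y hy) hY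

theorem eventually_eq_sum (Y : ∀ x : M, TangentSpace I x) {y : M} (hy : y ∈ F.U) :
    Y =ᶠ[𝓝 y] fun z ↦ ∑ i, F.comp Y i z • F.e i z := by
  filter_upwards [F.U.isOpen.mem_nhds hy] with z hz
  exact (F.sum_inner z hz (Y z)).symm

theorem contMDiffAt_of_comp {Y : ∀ x : M, TangentSpace I x} {y : M} (hy : y ∈ F.U)
    (h : ∀ i, CMDiffAt ∞ (F.comp Y i) y) : CMDiffAt ∞ (T% Y) y := by
  have : CMDiffAt ∞ (T% (fun z ↦ ∑ i, F.comp Y i z • F.e i z)) y :=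
    .sum_section fun i _ ↦ (h i).smul_section (F.smooth i y hy)
  refine this.congr_of_eventuallyEq ?_
  filter_upwards [F.eventually_eq_sum Y hy] with z hz
  exact congrArg _ hz

/-- The components of a Lie bracket. -/
theorem inner_mlieBracket {X Y : ∀ x : M, TangentSpace I x} {y : M} (hy : y ∈ F.U)
    (hX : CMDiffAt ∞ (T% X) y) (hY : CMDiffAt ∞ (T% Y) y) (k : ι) :
    inner ℝ (F.e k y) (mlieBracket I X Y y)
      = mvfderiv I (F.comp Y k) y (X y) - mvfderiv I (F.comp X k) y (Y y)
        + ∑ i, ∑ j, F.comp X i y * F.comp Y j y * F.cf i j k y := by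
  have h1 : ∀ {Z W : ∀ x : M, TangentSpace I x}, CMDiffAt ∞ (T% Z) y →
      mlieBracket I W Z y
        = ∑ j, (mvfderiv I (F.comp Z j) y (W y) • F.e j y
          + F.comp Z j y • mlieBracket I W (F.e j) y) := fun {Z W} hZ ↦ by
    rw [← mlieBracket_sum_smul_right _ _ _ _ (fun k ↦ F.smooth k y hy)
      (F.contMDiffAt_comp hy hZ)]
    exact Filter.EventuallyEq.mlieBracket_vectorField_eq (Filter.EventuallyEq.refl _ _)
      (F.eventually_eq_sum Z hy)
  have h2 : ∀ j, mlieBracket I X (F.e j) y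
      = -∑ i, (mvfderiv I (F.comp X i) y (F.e j y) • F.e i y
          + F.comp X i y • mlieBracket I (F.e j) (F.e i) y) := fun j ↦ by
    rw [mlieBracket_swap_apply, h1 hX]
  have h3 : mvfderiv I (F.comp X k) y (Y y)
      = ∑ j, F.comp Y j y * mvfderiv I (F.comp X k) y (F.e j y) := by
    conv_lhs => rw [← F.sum_inner y hy (Y y)]
    simp only [map_sum, map_smul, smul_eq_mul, comp]
  have h4 : ∀ i j, inner ℝ (F.e k y) (mlieBracket I (F.e j) (F.e i) y) = -F.cf i j k y :=
    fun i j ↦ by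
      rw [mlieBracket_swap_apply, inner_neg_right, real_inner_comm, cf]
  rw [h1 hY, h3]
  simp only [h2, inner_sum, inner_add_right, inner_smul_right, inner_neg_right, F.inner_e hy, h4,
    mul_ite, mul_one, mul_zero, Finset.sum_add_distrib, Finset.sum_ite_eq, Finset.mem_univ,
    if_true]
  rw [sub_add_eq_add_sub, add_sub_assoc]
  congr 1
  rw [Finset.sum_comm, ← Finset.sum_sub_distrib]
  refine Finset.sum_congr rfl fun j _ ↦ ?_
  rw [neg_add, mul_add, mul_neg, ← sub_eq_neg_add, ← Finset.sum_neg_distrib, Finset.mul_sum]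
  congr 1
  exact Finset.sum_congr rfl fun i _ ↦ by ring

end OrthoFrame

variable [IsContMDiffRiemannianBundle I ∞ E (fun x : M ↦ TangentSpace I x)]

namespace OrthoFrame

variable {ι : Type*} [Fintype ι] [DecidableEq ι] (F : OrthoFrame I M ι)

theorem inner_eq_sum {y : M} (hy : y ∈ F.U) (v w : TangentSpace I y) :
    inner ℝ v w = ∑ i, inner ℝ (F.e i y) v * inner ℝ (F.e i y) w := by
  conv_lhs => rw [← F.sum_inner y hy v]
  simp only [_root_.sum_inner, real_inner_smul_left]

theorem map_eq_sum {y : M} (hy : y ∈ F.U) (φ : TangentSpace I y →L[ℝ] ℝ) (v : TangentSpace I y) :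
    φ v = ∑ i, inner ℝ (F.e i y) v * φ (F.e i y) := by
  conv_lhs => rw [← F.sum_inner y hy v]
  simp only [map_sum, map_smul, smul_eq_mul]

theorem derivInner_eq {Y Z : ∀ x : M, TangentSpace I x} {y : M} (hy : y ∈ F.U)
    (hY : CMDiffAt ∞ (T% Y) y) (hZ : CMDiffAt ∞ (T% Z) y) (v : TangentSpace I y) :
    derivInner Y Z y v = ∑ k, (F.comp Y k y * mvfderiv I (F.comp Z k) y v
      + F.comp Z k y * mvfderiv I (F.comp Y k) y v) := by
  have h : (fun z ↦ inner ℝ (Y z) (Z z)) =ᶠ[𝓝 y] fun z ↦ ∑ k, F.comp Y k z * F.comp Z k z := by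
    filter_upwards [F.U.isOpen.mem_nhds hy] with z hz
    exact F.inner_eq_sum hz _ _
  rw [derivInner, mvfderiv_congr h,
    mvfderiv_sum _ (fun k z ↦ F.comp Y k z * F.comp Z k z) (fun k ↦ (F.contMDiffAt_comp hy hY k).mul (F.contMDiffAt_comp hy hZ k))]
  refine Finset.sum_congr rfl fun k _ ↦ mvfderiv_mul_apply ?_ ?_ _
  · exact (F.contMDiffAt_comp hy hY k).mdifferentiableAt (by simp)
  · exact (F.contMDiffAt_comp hy hZ k).mdifferentiableAt (by simp)

/-- In components only the derivatives of `Y` along `X` survive; the structure functions assemble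
into `Γf`. -/
theorem koszul_eq {X Y Z : ∀ x : M, TangentSpace I x} {y : M} (hy : y ∈ F.U)
    (hX : CMDiffAt ∞ (T% X) y) (hY : CMDiffAt ∞ (T% Y) y) (hZ : CMDiffAt ∞ (T% Z) y) :
    koszul X Y Z y = ∑ k, F.comp Z k y * (mvfderiv I (F.comp Y k) y (X y)
      + ∑ i, ∑ j, F.comp X i y * F.comp Y j y * F.Γf i j k y) := by
  have hb : ∀ {A B C : ∀ x : M, TangentSpace I x}, CMDiffAt ∞ (T% A) y → CMDiffAt ∞ (T% B) y →
      inner ℝ (mlieBracket I A B y) (C y) = ∑ k, F.comp C k y *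
        (mvfderiv I (F.comp B k) y (A y) - mvfderiv I (F.comp A k) y (B y)
        + ∑ i, ∑ j, F.comp A i y * F.comp B j y * F.cf i j k y) := fun {A B C} hA hB ↦ by
    rw [F.inner_eq_sum hy]
    refine Finset.sum_congr rfl fun k _ ↦ ?_
    rw [F.inner_mlieBracket hy hA hB, mul_comm]
    rfl
  have e1 : ∑ k, F.comp Z k y * ∑ i, ∑ j, F.comp X i y * F.comp Y j y * F.Γf i j k y
      = (1 / 2) * (∑ k, F.comp Z k y * ∑ i, ∑ j, F.comp X i y * F.comp Y j y * F.cf i j k y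
        - ∑ k, F.comp Y k y * ∑ i, ∑ j, F.comp X i y * F.comp Z j y * F.cf i j k y
        - ∑ k, F.comp X k y * ∑ i, ∑ j, F.comp Y i y * F.comp Z j y * F.cf i j k y) := by
    have s1 : ∑ k, F.comp Y k y * ∑ i, ∑ j, F.comp X i y * F.comp Z j y * F.cf i j k y
        = ∑ k, F.comp Z k y * ∑ i, ∑ j, F.comp X i y * F.comp Y j y * F.cf i k j y := by
      simp only [Finset.mul_sum]
      rw [Finset.sum_comm]
      conv_rhs => rw [Finset.sum_comm]
      refine Finset.sum_congr rfl fun i _ ↦ ?_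
      rw [Finset.sum_comm]
      exact Finset.sum_congr rfl fun _ _ ↦ Finset.sum_congr rfl fun _ _ ↦ by ring
    have s2 : ∑ k, F.comp X k y * ∑ i, ∑ j, F.comp Y i y * F.comp Z j y * F.cf i j k y
        = ∑ k, F.comp Z k y * ∑ i, ∑ j, F.comp X i y * F.comp Y j y * F.cf j k i y := by
      simp only [Finset.mul_sum]
      conv_rhs => rw [Finset.sum_comm]
      refine Finset.sum_congr rfl fun i _ ↦ ?_
      rw [Finset.sum_comm]
      exact Finset.sum_congr rfl fun _ _ ↦ Finset.sum_congr rfl fun _ _ ↦ by ring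
    rw [s1, s2]
    simp only [← Finset.sum_sub_distrib, ← mul_sub, Γf, Finset.mul_sum]
    exact Finset.sum_congr rfl fun _ _ ↦ Finset.sum_congr rfl fun _ _ ↦
      Finset.sum_congr rfl fun _ _ ↦ by ring
  rw [koszul, F.derivInner_eq hy hY hZ, F.derivInner_eq hy hZ hX, F.derivInner_eq hy hX hY,
    hb hX hY, hb hX hZ, hb hY hZ]
  simp only [mul_add, mul_sub, Finset.sum_add_distrib, Finset.sum_sub_distrib, e1]
  ring

theorem contMDiffAt_extend {y : M} (v : TangentSpace I y) :
    CMDiffAt ∞ (T% (FiberBundle.extend E v)) y :=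
  FiberBundle.contMDiffAt_extend I E v

/-- Shows that neither the extension of `v` nor the pointwise basis used in `nabla` affects the
result. -/
theorem inner_nabla {Y : ∀ x : M, TangentSpace I x} {y : M} (hy : y ∈ F.U)
    (hY : CMDiffAt ∞ (T% Y) y) (v : TangentSpace I y) (k : ι) :
    inner ℝ (F.e k y) (nabla Y y v) = mvfderiv I (F.comp Y k) y v
      + ∑ i, ∑ j, inner ℝ (F.e i y) v * F.comp Y j y * F.Γf i j k y := by
  have hc : ∀ (w : TangentSpace I y) i, F.comp (FiberBundle.extend E w) i y = inner ℝ (F.e i y) w :=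
    fun w i ↦ by rw [comp, FiberBundle.extend_apply_self]
  rw [nabla, inner_sum]
  simp only [inner_smul_right, F.koszul_eq hy (contMDiffAt_extend v) hY (contMDiffAt_extend _),
    hc, FiberBundle.extend_apply_self, Finset.sum_mul]
  rw [Finset.sum_comm]
  -- Parseval in the pointwise basis, which thereby disappears.
  have h : ∀ j, ∑ i, inner ℝ (F.e j y) (frame I y i) * inner ℝ (F.e k y) (frame I y i)
      = if j = k then 1 else 0 := fun j ↦ by
    rw [← F.inner_e hy, ← (frame I y).sum_inner_mul_inner]
    exact Finset.sum_congr rfl fun i _ ↦ by rw [real_inner_comm (F.e k y)]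
  rw [Finset.sum_eq_single k]
  · rw [← Finset.sum_congr rfl fun i _ ↦ mul_right_comm _ _ _, ← Finset.sum_mul, h, if_pos rfl,
      one_mul]
  · intro j _ hj
    rw [← Finset.sum_congr rfl fun i _ ↦ mul_right_comm _ _ _, ← Finset.sum_mul, h, if_neg hj,
      zero_mul]
  · simp

end OrthoFrame

theorem mlieBracket_smul_right_of_contMDiffAt {X Y : ∀ x : M, TangentSpace I x} {u : M → ℝ}
    {y : M} (hu : CMDiffAt ∞ u y) (hY : CMDiffAt ∞ (T% Y) y) :
    mlieBracket I X (u • Y) y = mvfderiv I u y (X y) • Y y + u y • mlieBracket I X Y y := by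
  have : CompleteSpace E := FiniteDimensional.complete ℝ E
  exact mlieBracket_smul_right (hu.mdifferentiableAt (by simp)) (hY.mdifferentiableAt (by simp))

theorem mlieBracket_add_right_of_contMDiffAt {X Y Z : ∀ x : M, TangentSpace I x}
    {y : M} (hY : CMDiffAt ∞ (T% Y) y) (hZ : CMDiffAt ∞ (T% Z) y) :
    mlieBracket I X (Y + Z) y = mlieBracket I X Y y + mlieBracket I X Z y := by
  have : IsManifold I (minSmoothness ℝ 2) M := isManifold_minSmoothness I M 2
  have : CompleteSpace E := FiniteDimensional.complete ℝ E
  exact mlieBracket_add_right (hY.mdifferentiableAt (by simp)) (hZ.mdifferentiableAt (by simp))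

namespace OrthoFrame

variable {ι : Type*} [Fintype ι] [DecidableEq ι] (F : OrthoFrame I M ι)

/-- Since [X, u e_i] = X(u) e_i + u [X, e_i], the function X(u) is read off from e_i-components of
brackets, which are smooth. -/
theorem contMDiffAt_mvfderiv {X : ∀ x : M, TangentSpace I x} {u : M → ℝ} {y : M} (hy : y ∈ F.U)
    (hX : CMDiffAt ∞ (T% X) y) (hu : ∀ z ∈ F.U, CMDiffAt ∞ u z) :
    CMDiffAt ∞ (fun z ↦ mvfderiv I u z (X z)) y := by
  -- With no frame vector the tangent spaces over `U` are zero and so is the derivative.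
  rcases isEmpty_or_nonempty ι with hι | ⟨⟨i⟩⟩
  · refine (contMDiffAt_const (c := (0 : ℝ))).congr_of_eventuallyEq ?_
    filter_upwards [F.U.isOpen.mem_nhds hy] with z hz
    rw [F.map_eq_sum hz]
    simp
  · have he := F.smooth i y hy
    have h1 : CMDiffAt ∞ (T% (mlieBracket I X (u • F.e i))) y :=
      contMDiffAt_mlieBracket hX ((hu y hy).smul_section he)
    have h2 := F.contMDiffAt_comp hy h1 i
    have h3 := F.contMDiffAt_comp hy (contMDiffAt_mlieBracket hX he) i
    refine (h2.sub ((hu y hy).mul h3)).congr_of_eventuallyEq ?_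
    filter_upwards [F.U.isOpen.mem_nhds hy] with z hz
    simp only [Pi.mul_apply, comp]
    rw [mlieBracket_smul_right_of_contMDiffAt (hu z hz) (F.smooth i z hz)]
    simp only [inner_add_right, inner_smul_right, F.inner_e hz, if_true]
    ring

/-- The commutator of two derivations is the derivation along the Lie bracket. -/
theorem mvfderiv_mlieBracket {u : M → ℝ} {y : M} (hy : y ∈ F.U) (hu : ∀ z ∈ F.U, CMDiffAt ∞ u z)
    (i j : ι) :
    mvfderiv I (fun z ↦ mvfderiv I u z (F.e j z)) y (F.e i y)
        - mvfderiv I (fun z ↦ mvfderiv I u z (F.e i z)) y (F.e j y)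
      = mvfderiv I u y (mlieBracket I (F.e i) (F.e j) y) := by
  have hi := F.smooth i y hy
  have hj := F.smooth j y hy
  have key : ∀ {X Y Z : ∀ x : M, TangentSpace I x}, CMDiffAt ∞ (T% X) y → CMDiffAt ∞ (T% Y) y →
      (∀ z ∈ F.U, CMDiffAt ∞ (T% Z) z) → mlieBracket I X (mlieBracket I Y (u • Z)) y
        = mvfderiv I (fun z ↦ mvfderiv I u z (Y z)) y (X y) • Z y
          + mvfderiv I u y (Y y) • mlieBracket I X Z y
          + (mvfderiv I u y (X y) • mlieBracket I Y Z y
            + u y • mlieBracket I X (mlieBracket I Y Z) y) := by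
    intro X Y Z hX hY hZ
    have h1 : mlieBracket I Y (u • Z) =ᶠ[𝓝 y]
        (fun z ↦ mvfderiv I u z (Y z)) • Z + u • mlieBracket I Y Z := by
      filter_upwards [F.U.isOpen.mem_nhds hy] with z hz
      exact mlieBracket_smul_right_of_contMDiffAt (hu z hz) (hZ z hz)
    have h2 := F.contMDiffAt_mvfderiv hy hY hu
    have h3 := contMDiffAt_mlieBracket hY (hZ y hy)
    rw [Filter.EventuallyEq.mlieBracket_vectorField_eq (Filter.EventuallyEq.refl _ X) h1,
      mlieBracket_add_right_of_contMDiffAt (h2.smul_section (hZ y hy))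
        ((hu y hy).smul_section h3),
      mlieBracket_smul_right_of_contMDiffAt h2 (hZ y hy),
      mlieBracket_smul_right_of_contMDiffAt (hu y hy) h3]
  have hb := contMDiffAt_mlieBracket hi hj
  -- The Jacobi identities for (e_i, e_j, u e_i) and (e_i, e_j, e_i) are compared; the e_i-component
  -- of what remains is the commutator formula for u.
  have j1 := jacobi_mlieBracket hi hj ((hu y hy).smul_section hi)
  have j2 := jacobi_mlieBracket hi hj hi
  change mlieBracket I _ (mlieBracket I _ (u • F.e i)) y
    = mlieBracket I _ (u • F.e i) y + mlieBracket I _ (mlieBracket I _ (u • F.e i)) y at j1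
  rw [key hi hj (F.smooth i), key hj hi (F.smooth i),
    mlieBracket_smul_right_of_contMDiffAt (hu y hy) hi, j2] at j1
  have h := congrArg (inner ℝ (F.e i y)) j1
  simp only [inner_add_right, inner_smul_right, F.inner_e hy, if_true] at h
  linear_combination h

theorem cf_swap (i j k : ι) (y : M) : F.cf i j k y = -F.cf j i k y := by
  rw [cf, cf, mlieBracket_swap_apply, inner_neg_left]

theorem Γf_skew (i j k : ι) (y : M) : F.Γf i j k y = -F.Γf i k j y := by
  simp only [Γf, F.cf_swap k j]; ring

theorem Γf_sub (i j k : ι) (y : M) : F.Γf i j k y - F.Γf j i k y = F.cf i j k y := by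
  simp only [Γf, F.cf_swap j i]; ring

theorem mvfderiv_comm {u : M → ℝ} {y : M} (hy : y ∈ F.U) (hu : ∀ z ∈ F.U, CMDiffAt ∞ u z)
    (i j : ι) :
    mvfderiv I (fun z ↦ mvfderiv I u z (F.e j z)) y (F.e i y)
        - mvfderiv I (fun z ↦ mvfderiv I u z (F.e i z)) y (F.e j y)
      = ∑ k, (F.Γf i j k y - F.Γf j i k y) * mvfderiv I u y (F.e k y) := by
  rw [F.mvfderiv_mlieBracket hy hu, F.map_eq_sum hy]
  simp only [F.Γf_sub, cf, real_inner_comm]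

theorem inner_mlieBracket_e {Y : ∀ x : M, TangentSpace I x} {y : M} (hy : y ∈ F.U)
    (hY : CMDiffAt ∞ (T% Y) y) (i k : ι) :
    inner ℝ (F.e k y) (mlieBracket I (F.e i) Y y)
      = mvfderiv I (F.comp Y k) y (F.e i y) + ∑ j, F.comp Y j y * F.cf i j k y := by
  have h : F.comp (F.e i) k =ᶠ[𝓝 y] fun _ ↦ if k = i then 1 else 0 := by
    filter_upwards [F.U.isOpen.mem_nhds hy] with z hz
    exact F.inner_e hz k i
  rw [F.inner_mlieBracket hy (F.smooth i y hy) hY, mvfderiv_congr h, mvfderiv_const]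
  simp [comp, F.inner_e hy]

theorem contMDiffAt_cf {y : M} (hy : y ∈ F.U) (i j k : ι) : CMDiffAt ∞ (F.cf i j k) y :=
  ContMDiffAt.inner_bundle (F := E) (E := fun x : M ↦ TangentSpace I x)
    (contMDiffAt_mlieBracket (F.smooth i y hy) (F.smooth j y hy)) (F.smooth k y hy)

theorem contMDiffAt_Γf {y : M} (hy : y ∈ F.U) (i j k : ι) : CMDiffAt ∞ (F.Γf i j k) y :=
  contMDiffAt_const.mul (((F.contMDiffAt_cf hy i j k).sub (F.contMDiffAt_cf hy i k j)).sub
    (F.contMDiffAt_cf hy j k i))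

theorem jacobi_cf {y : M} (hy : y ∈ F.U) (i j k l : ι) :
    mvfderiv I (F.cf j k l) y (F.e i y) + mvfderiv I (F.cf k i l) y (F.e j y)
      + mvfderiv I (F.cf i j l) y (F.e k y)
      + ∑ m, (F.cf j k m y * F.cf i m l y + F.cf k i m y * F.cf j m l y
        + F.cf i j m y * F.cf k m l y) = 0 := by
  have h := congrArg (inner ℝ (F.e l y))
    (jacobi_mlieBracket (F.smooth i y hy) (F.smooth j y hy) (F.smooth k y hy))
  have hc : ∀ a b c, F.comp (mlieBracket I (F.e a) (F.e b)) c = F.cf a b c := fun a b c ↦ by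
    ext z
    exact real_inner_comm _ _
  have hs : ∀ a b, CMDiffAt ∞ (T% (mlieBracket I (F.e a) (F.e b))) y := fun a b ↦
    contMDiffAt_mlieBracket (F.smooth a y hy) (F.smooth b y hy)
  have hk : mvfderiv I (F.cf i k l) y (F.e j y) = - mvfderiv I (F.cf k i l) y (F.e j y) := by
    have : F.cf i k l = -F.cf k i l := funext fun z ↦ F.cf_swap i k l z
    rw [this, mvfderiv_neg]; rfl
  rw [mlieBracket_swap_apply (V := mlieBracket I (F.e i) (F.e j)), inner_add_right,
    inner_neg_right, F.inner_mlieBracket_e hy (hs _ _), F.inner_mlieBracket_e hy (hs _ _),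
    F.inner_mlieBracket_e hy (hs _ _)] at h
  simp only [hc, hk, F.cf_swap i k, neg_mul, Finset.sum_neg_distrib] at h
  simp only [Finset.sum_add_distrib]
  linear_combination h

/-! ### The frame algebra of a smooth orthonormal frame. -/

/-- The derivative of a smooth function along a vector of the frame. -/
def derivFun (i : ι) (a : smoothFun I F.U) : smoothFun I F.U :=
  smoothFun.mk (fun z ↦ mvfderiv I (extendZero F.U a.1) z (F.e i z))
    (fun y hy ↦ F.contMDiffAt_mvfderiv hy (F.smooth i y hy) fun z hz ↦ a.2 ⟨z, hz⟩)

/-- The derivation of the algebra of smooth functions along a vector of the frame. -/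
def deriv (i : ι) : Derivation ℝ (smoothFun I F.U) (smoothFun I F.U) :=
  Derivation.mk'
    { toFun := F.derivFun i
      map_add' := fun a b ↦ smoothFun.ext' fun y ↦ by
        have : mvfderiv I (extendZero F.U (a.1 + b.1)) (y : M) (F.e i y)
            = mvfderiv I (extendZero F.U a.1) (y : M) (F.e i y)
              + mvfderiv I (extendZero F.U b.1) (y : M) (F.e i y) := by
          rw [mvfderiv_congr (extendZero_eventuallyEq
            (u := fun z ↦ extendZero F.U a.1 z + extendZero F.U b.1 z)
            (fun z ↦ by simp [extendZero_coe]) y), mvfderiv_fun_add]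
          · rfl
          · exact smoothFun.mdifferentiableAt a y
          · exact smoothFun.mdifferentiableAt b y
        exact this
      map_smul' := fun r a ↦ smoothFun.ext' fun y ↦ by
        have : mvfderiv I (extendZero F.U (r • a.1)) (y : M) (F.e i y)
            = r * mvfderiv I (extendZero F.U a.1) (y : M) (F.e i y) := by
          rw [mvfderiv_congr (extendZero_eventuallyEq
            (u := fun z ↦ r * extendZero F.U a.1 z)
            (fun z ↦ by simp [extendZero_coe]) y), mvfderiv_mul_apply, mvfderiv_const]
          · simp
          · exact mdifferentiableAt_const
          · exact smoothFun.mdifferentiableAt a y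
        exact this }
    fun a b ↦ smoothFun.ext' fun y ↦ by
      have : mvfderiv I (extendZero F.U (a.1 * b.1)) (y : M) (F.e i y)
          = a.1 y * mvfderiv I (extendZero F.U b.1) (y : M) (F.e i y)
            + b.1 y * mvfderiv I (extendZero F.U a.1) (y : M) (F.e i y) := by
        rw [mvfderiv_congr (extendZero_eventuallyEq
          (u := fun z ↦ extendZero F.U a.1 z * extendZero F.U b.1 z)
          (fun z ↦ by simp [extendZero_coe]) y), mvfderiv_mul_apply, extendZero_coe,
          extendZero_coe]
        · exact smoothFun.mdifferentiableAt a y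
        · exact smoothFun.mdifferentiableAt b y
      exact this

theorem deriv_apply (i : ι) (a : smoothFun I F.U) (y : F.U) :
    (F.deriv i a).1 y = mvfderiv I (extendZero F.U a.1) (y : M) (F.e i y) := rfl

theorem deriv_mk_apply (i : ι) (u : M → ℝ) (hu : ∀ y ∈ F.U, CMDiffAt ∞ u y) (y : F.U) :
    (F.deriv i (smoothFun.mk u hu)).1 y = mvfderiv I u (y : M) (F.e i y) := by
  rw [deriv_apply, mvfderiv_congr (extendZero_eventuallyEq (a := (smoothFun.mk u hu).1) (u := u)
    (fun z ↦ rfl) y)]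

/-- The calculus of the Riemannian metric in an orthonormal frame. -/
def alg : FrameAlgebra (smoothFun I F.U) ι where
  D := F.deriv
  Γ i j k := smoothFun.mk (F.Γf i j k) fun _ hy ↦ F.contMDiffAt_Γf hy i j k
  skew i j k := smoothFun.ext' fun y ↦ F.Γf_skew i j k y
  bracket i j a := smoothFun.ext' fun y ↦ by
    have h := F.mvfderiv_comm y.2 (fun z hz ↦ a.2 ⟨z, hz⟩) i j
    have e : ∀ p q, (F.deriv p (F.deriv q a)).1 y
        = mvfderiv I (fun z ↦ mvfderiv I (extendZero F.U a.1) z (F.e q z)) y (F.e p y) :=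
      fun p q ↦ F.deriv_mk_apply p _ _ y
    rw [← e, ← e] at h
    refine h.trans ?_
    simp only [AddSubmonoidClass.coe_finsetSum, Finset.sum_apply]
    rfl
  jacobi i j k l := smoothFun.ext' fun y ↦ by
    have h := F.jacobi_cf y.2 i j k l
    have e : ∀ p q r s, (F.deriv p (smoothFun.mk (F.Γf q r s)
          (fun _ hy ↦ F.contMDiffAt_Γf hy q r s) - smoothFun.mk (F.Γf r q s)
          (fun _ hy ↦ F.contMDiffAt_Γf hy r q s))).1 y
        = mvfderiv I (F.cf q r s) y (F.e p y) := fun p q r s ↦ by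
      rw [← F.deriv_mk_apply p _ (fun z hz ↦ F.contMDiffAt_cf hz q r s) y]
      exact congrArg (fun a ↦ (F.deriv p a).1 y) (smoothFun.ext' fun z ↦ F.Γf_sub q r s (z : M))
    rw [← e, ← e, ← e] at h
    simp only [← F.Γf_sub] at h
    refine Eq.trans ?_ h
    simp only [Subalgebra.coe_add, AddSubmonoidClass.coe_finsetSum, Finset.sum_apply,
      Pi.add_apply]
    rfl

end OrthoFrame

theorem smoothFun.contMDiffAt_of_eq {U : TopologicalSpace.Opens M} (a : smoothFun I U)
    {u : M → ℝ} (h : ∀ y : U, a.1 y = u y) : ∀ y ∈ U, CMDiffAt ∞ u y := fun y hy ↦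
  (a.2 ⟨y, hy⟩).congr_of_eventuallyEq (extendZero_eventuallyEq h ⟨y, hy⟩).symm

theorem smoothFun.sum_apply {U : TopologicalSpace.Opens M} {κ : Type*} (s : Finset κ)
    (a : κ → smoothFun I U) (y : U) : (∑ k ∈ s, a k).1 y = ∑ k ∈ s, (a k).1 y :=
  map_sum (smoothFun.eval I y) a s

theorem smoothFun.mul_apply {U : TopologicalSpace.Opens M}
    (a b : smoothFun I U) (y : U) : (a * b).1 y = a.1 y * b.1 y := rfl

theorem smoothFun.add_apply {U : TopologicalSpace.Opens M}
    (a b : smoothFun I U) (y : U) : (a + b).1 y = a.1 y + b.1 y := rfl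

theorem smoothFun.sub_apply {U : TopologicalSpace.Opens M}
    (a b : smoothFun I U) (y : U) : (a - b).1 y = a.1 y - b.1 y := rfl

/-! ### Connection, curvature, Ricci tensor and Hessian in frame components. -/

namespace OrthoFrame

variable {ι : Type*} [Fintype ι] [DecidableEq ι] (F : OrthoFrame I M ι)

/-- The components of a vector field that is smooth on the domain of the frame. -/
def vec (Y : ∀ x : M, TangentSpace I x) (hY : ∀ y ∈ F.U, CMDiffAt ∞ (T% Y) y) (k : ι) :
    smoothFun I F.U :=
  smoothFun.mk (F.comp Y k) fun _ hy ↦ F.contMDiffAt_comp hy (hY _ hy) k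

theorem vec_apply {Y : ∀ x : M, TangentSpace I x} (hY : ∀ y ∈ F.U, CMDiffAt ∞ (T% Y) y) (k : ι)
    (y : F.U) : (F.vec Y hY k).1 y = inner ℝ (F.e k y) (Y y) := rfl

theorem vec_eq {Y : ∀ x : M, TangentSpace I x} (hY : ∀ y ∈ F.U, CMDiffAt ∞ (T% Y) y)
    {v : ι → smoothFun I F.U} (h : ∀ (k : ι) (y : F.U), inner ℝ (F.e k y) (Y y) = (v k).1 y) :
    F.vec Y hY = v :=
  funext fun k ↦ smoothFun.ext' fun y ↦ h k y

theorem contMDiffAt_of_inner {Y : ∀ x : M, TangentSpace I x}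
    (v : ι → smoothFun I F.U) (h : ∀ (k : ι) (y : F.U), inner ℝ (F.e k y) (Y y) = (v k).1 y) :
    ∀ y ∈ F.U, CMDiffAt ∞ (T% Y) y := fun y hy ↦
  F.contMDiffAt_of_comp hy fun k ↦
    smoothFun.contMDiffAt_of_eq (v k) (fun z ↦ (h k z).symm) y hy

theorem alg_Γ_apply (i j k : ι) (y : F.U) : (F.alg.Γ i j k).1 y = F.Γf i j k y := rfl

theorem alg_c_apply (i j k : ι) (y : F.U) : (F.alg.c i j k).1 y = F.cf i j k y :=
  F.Γf_sub i j k y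

theorem inner_nabla_eq {Y : ∀ x : M, TangentSpace I x} (hY : ∀ y ∈ F.U, CMDiffAt ∞ (T% Y) y)
    (y : F.U) (v : TangentSpace I (y : M)) (k : ι) :
    inner ℝ (F.e k y) (nabla Y (y : M) v)
      = ∑ i, inner ℝ (F.e i y) v * (F.alg.dv i (F.vec Y hY) k).1 y := by
  rw [F.inner_nabla y.2 (hY y y.2), F.map_eq_sum y.2, ← Finset.sum_add_distrib]
  refine Finset.sum_congr rfl fun i _ ↦ ?_
  have h : (F.alg.D i (F.vec Y hY k)).1 y = mvfderiv I (F.comp Y k) (y : M) (F.e i y) :=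
    F.deriv_mk_apply i _ _ y
  rw [FrameAlgebra.dv, smoothFun.sub_apply, smoothFun.sum_apply, h, mul_sub, Finset.mul_sum,
    sub_eq_add_neg, ← Finset.sum_neg_distrib]
  congr 1
  refine Finset.sum_congr rfl fun j _ ↦ ?_
  rw [smoothFun.mul_apply, alg_Γ_apply, F.Γf_skew i k j, vec_apply, comp]
  ring

theorem inner_nabla_field {X Y : ∀ x : M, TangentSpace I x}
    (hX : ∀ y ∈ F.U, CMDiffAt ∞ (T% X) y) (hY : ∀ y ∈ F.U, CMDiffAt ∞ (T% Y) y) (k : ι)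
    (y : F.U) :
    inner ℝ (F.e k y) (nabla Y (y : M) (X y))
      = ((∑ i, F.vec X hX i • F.alg.dv i (F.vec Y hY)) k).1 y := by
  rw [F.inner_nabla_eq hY, Finset.sum_apply, smoothFun.sum_apply]
  rfl

theorem inner_mlieBracket_field {X Y : ∀ x : M, TangentSpace I x}
    (hX : ∀ y ∈ F.U, CMDiffAt ∞ (T% X) y) (hY : ∀ y ∈ F.U, CMDiffAt ∞ (T% Y) y) (k : ι)
    (y : F.U) :
    inner ℝ (F.e k y) (mlieBracket I X Y (y : M))
      = (∑ i, F.vec X hX i * F.alg.D i (F.vec Y hY k) - ∑ i, F.vec Y hY i * F.alg.D i (F.vec X hX k)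
        + ∑ i, ∑ j, F.vec X hX i * F.vec Y hY j * F.alg.c i j k).1 y := by
  have h : ∀ {Z : ∀ x : M, TangentSpace I x} (hZ : ∀ y ∈ F.U, CMDiffAt ∞ (T% Z) y) i,
      (F.alg.D i (F.vec Z hZ k)).1 y = mvfderiv I (F.comp Z k) (y : M) (F.e i y) :=
    fun hZ i ↦ F.deriv_mk_apply i _ _ y
  rw [F.inner_mlieBracket y.2 (hX y y.2) (hY y y.2), F.map_eq_sum y.2, F.map_eq_sum y.2]
  simp only [smoothFun.add_apply, smoothFun.sub_apply, smoothFun.sum_apply, smoothFun.mul_apply,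
    h, alg_c_apply, vec_apply]
  rfl

/-- Covariant derivatives and brackets of smooth fields again have components in the algebra, so
`curvature_eq` can be evaluated at `y`. -/
theorem inner_curvature {X Y Z : ∀ x : M, TangentSpace I x}
    (hX : ∀ y ∈ F.U, CMDiffAt ∞ (T% X) y) (hY : ∀ y ∈ F.U, CMDiffAt ∞ (T% Y) y)
    (hZ : ∀ y ∈ F.U, CMDiffAt ∞ (T% Z) y) (k : ι) (y : F.U) :
    inner ℝ (F.e k y) (nabla (fun z ↦ nabla Z z (X z)) (y : M) (Y y)
        - nabla (fun z ↦ nabla Z z (Y z)) (y : M) (X y)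
        + nabla Z (y : M) (mlieBracket I X Y (y : M)))
      = ∑ i, ∑ j, ∑ l, inner ℝ (F.e i y) (X y) * inner ℝ (F.e j y) (Y y)
        * ((F.alg.R i j k l).1 y * inner ℝ (F.e l y) (Z y)) := by
  have hXZ := F.contMDiffAt_of_inner (Y := fun z ↦ nabla Z z (X z)) _ (F.inner_nabla_field hX hZ)
  have hYZ := F.contMDiffAt_of_inner (Y := fun z ↦ nabla Z z (Y z)) _ (F.inner_nabla_field hY hZ)
  have hXY := F.contMDiffAt_of_inner (Y := mlieBracket I X Y) _
    (fun k y ↦ F.inner_mlieBracket_field hX hY k y)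
  have vXZ := F.vec_eq hXZ (F.inner_nabla_field hX hZ)
  have vYZ := F.vec_eq hYZ (F.inner_nabla_field hY hZ)
  have vXY := F.vec_eq hXY (fun k y ↦ F.inner_mlieBracket_field hX hY k y)
  have h := congrFun (F.alg.curvature_eq (F.vec X hX) (F.vec Y hY) (F.vec Z hZ)) k
  rw [inner_add_right, inner_sub_right, F.inner_nabla_field hY hXZ, F.inner_nabla_field hX hYZ,
    F.inner_nabla_field hXY hZ, vXZ, vYZ, vXY]
  refine (congrArg (fun a ↦ a.1 y) h).trans ?_
  simp only [Finset.sum_apply, Pi.smul_apply, smul_eq_mul, smoothFun.sum_apply,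
    smoothFun.mul_apply, Matrix.mulVec, dotProduct, Finset.mul_sum, vec_apply]

end OrthoFrame

/-- The restriction of smooth functions to a smaller open set. -/
def smoothFun.restrict {U V : TopologicalSpace.Opens M} (h : V ≤ U) :
    smoothFun I U →ₐ[ℝ] smoothFun I V where
  toFun a := smoothFun.mk (extendZero U a.1) fun y hy ↦ a.2 ⟨y, h hy⟩
  map_one' := smoothFun.ext' fun y ↦ extendZero_coe (U := U) 1 ⟨y, h y.2⟩
  map_mul' a b := smoothFun.ext' fun y ↦ by
    change extendZero U (a.1 * b.1) (y : M) = extendZero U a.1 y * extendZero U b.1 y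
    simp [extendZero, h y.2]
  map_zero' := smoothFun.ext' fun y ↦ extendZero_coe (U := U) 0 ⟨y, h y.2⟩
  map_add' a b := smoothFun.ext' fun y ↦ by
    change extendZero U (a.1 + b.1) (y : M) = extendZero U a.1 y + extendZero U b.1 y
    simp [extendZero, h y.2]
  commutes' r := smoothFun.ext' fun y ↦
    extendZero_coe (U := U) (algebraMap ℝ (U → ℝ) r) ⟨y, h y.2⟩

theorem smoothFun.restrict_apply {U V : TopologicalSpace.Opens M} (h : V ≤ U)
    (a : smoothFun I U) (y : V) : (smoothFun.restrict h a).1 y = a.1 ⟨y, h y.2⟩ :=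
  extendZero_coe a.1 ⟨y, h y.2⟩

namespace OrthoFrame

variable {ι : Type*} [Fintype ι] [DecidableEq ι] (F : OrthoFrame I M ι)

/-- The restriction of a frame to a smaller open set. -/
abbrev restrict {V : TopologicalSpace.Opens M} (h : V ≤ F.U) : OrthoFrame I M ι where
  U := V
  e := F.e
  smooth i y hy := F.smooth i y (h hy)
  orthonormal y hy := F.orthonormal y (h hy)
  sum_inner y hy := F.sum_inner y (h hy)

theorem restrict_alg_D {V : TopologicalSpace.Opens M} (h : V ≤ F.U) (i : ι) (a : smoothFun I F.U) :
    (F.restrict h).alg.D i (smoothFun.restrict h a) = smoothFun.restrict h (F.alg.D i a) :=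
  smoothFun.ext' fun y ↦ ((F.restrict h).deriv_mk_apply i (extendZero F.U a.1)
    (fun y hy ↦ a.2 ⟨y, h hy⟩) y).trans (smoothFun.restrict_apply h (F.alg.D i a) y).symm

theorem restrict_alg_Γ {V : TopologicalSpace.Opens M} (h : V ≤ F.U) (i j k : ι) :
    (F.restrict h).alg.Γ i j k = smoothFun.restrict h (F.alg.Γ i j k) :=
  smoothFun.ext' fun y ↦ (smoothFun.restrict_apply h (F.alg.Γ i j k) y).symm

theorem restrict_R_apply {V : TopologicalSpace.Opens M} (h : V ≤ F.U) (i j k l : ι) (y : V) :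
    ((F.restrict h).alg.R i j k l).1 y = (F.alg.R i j k l).1 ⟨y, h y.2⟩ := by
  rw [FrameAlgebra.map_R (F.restrict_alg_D h) (F.restrict_alg_Γ h)]
  exact smoothFun.restrict_apply h _ y

theorem restrict_dm_ricM_apply {V : TopologicalSpace.Opens M} (h : V ≤ F.U) (s i j : ι) (y : V) :
    ((F.restrict h).alg.dm s (F.restrict h).alg.ricM i j).1 y
      = (F.alg.dm s F.alg.ricM i j).1 ⟨y, h y.2⟩ := by
  rw [FrameAlgebra.map_dm_ricM (F.restrict_alg_D h) (F.restrict_alg_Γ h)]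
  exact smoothFun.restrict_apply h _ y

theorem exists_contMDiffAt_extend {y : M} (v : TangentSpace I y) :
    ∃ V : TopologicalSpace.Opens M, y ∈ V ∧
      ∀ z ∈ V, CMDiffAt ∞ (T% (FiberBundle.extend E v)) z := by
  obtain ⟨s, hs, h⟩ := FiberBundle.exists_contMDiffOn_extend (k := ∞) I E v
  obtain ⟨V, hV, hVo, hy⟩ := mem_nhds_iff.1 hs
  exact ⟨⟨V, hVo⟩, hy, fun z hz ↦ (h.mono hV z hz).contMDiffAt (hVo.mem_nhds hz)⟩

theorem inner_riem {y : M} (hy : y ∈ F.U) (a b c : TangentSpace I y) (k : ι) :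
    inner ℝ (F.e k y) (riem y a b c)
      = ∑ i, ∑ j, ∑ l, inner ℝ (F.e i y) a * inner ℝ (F.e j y) b
        * ((F.alg.R i j k l).1 ⟨y, hy⟩ * inner ℝ (F.e l y) c) := by
  -- The extensions are smooth only near `y`, so the frame is restricted; its curvature components
  -- do not change.
  obtain ⟨V₁, h₁, s₁⟩ := exists_contMDiffAt_extend a
  obtain ⟨V₂, h₂, s₂⟩ := exists_contMDiffAt_extend b
  obtain ⟨V₃, h₃, s₃⟩ := exists_contMDiffAt_extend c
  have h : F.U ⊓ (V₁ ⊓ V₂ ⊓ V₃) ≤ F.U := inf_le_left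
  have hy' : y ∈ F.U ⊓ (V₁ ⊓ V₂ ⊓ V₃) := ⟨hy, ⟨h₁, h₂⟩, h₃⟩
  have := (F.restrict h).inner_curvature (fun z hz ↦ s₁ z hz.2.1.1) (fun z hz ↦ s₂ z hz.2.1.2)
    (fun z hz ↦ s₃ z hz.2.2) k ⟨y, hy'⟩
  simp only [FiberBundle.extend_apply_self, F.restrict_R_apply h] at this
  exact this

theorem sum_inner_mul_inner {κ : Type*} [Fintype κ] {y : M} (hy : y ∈ F.U)
    (b : OrthonormalBasis κ ℝ (TangentSpace I y)) (i j : ι) :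
    ∑ p, inner ℝ (F.e i y) (b p) * inner ℝ (F.e j y) (b p) = if i = j then 1 else 0 := by
  rw [← F.inner_e hy, ← b.sum_inner_mul_inner]
  exact Finset.sum_congr rfl fun p _ ↦ by rw [real_inner_comm (b p) (F.e j y)]

/-- Replaces the trace over `frame`, chosen point by point, by one over a smooth frame; the Ricci
components thus become smooth functions. -/
theorem ric_eq {y : M} (hy : y ∈ F.U) (a b : TangentSpace I y) :
    ric y a b = ∑ i, ∑ j, inner ℝ (F.e i y) a * (F.alg.ricM i j).1 ⟨y, hy⟩
      * inner ℝ (F.e j y) b := by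
  have h : ∀ i l, (F.alg.ricM i l).1 ⟨y, hy⟩ = ∑ k, (F.alg.R i k k l).1 ⟨y, hy⟩ := fun i l ↦ by
    rw [FrameAlgebra.ricM_apply, smoothFun.sum_apply]
    refine Finset.sum_congr rfl fun k _ ↦ ?_
    rw [FrameAlgebra.R_swap, FrameAlgebra.R_skew, neg_neg]
  rw [ric]
  simp only [F.inner_eq_sum hy (riem y a _ b), F.inner_riem hy, h]
  have e1 : ∀ k, ∑ p, (∑ i, ∑ j, ∑ l, inner ℝ (F.e i y) a * inner ℝ (F.e j y) (frame I y p)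
        * ((F.alg.R i j k l).1 ⟨y, hy⟩ * inner ℝ (F.e l y) b)) * inner ℝ (F.e k y) (frame I y p)
      = ∑ i, ∑ l, inner ℝ (F.e i y) a * (F.alg.R i k k l).1 ⟨y, hy⟩ * inner ℝ (F.e l y) b :=
    fun k ↦ by
      simp only [Finset.sum_mul]
      rw [Finset.sum_comm]
      refine Finset.sum_congr rfl fun i _ ↦ ?_
      rw [Finset.sum_comm]
      have e2 : ∀ j, ∑ p, ∑ l, inner ℝ (F.e i y) a * inner ℝ (F.e j y) (frame I y p)
          * ((F.alg.R i j k l).1 ⟨y, hy⟩ * inner ℝ (F.e l y) b)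
          * inner ℝ (F.e k y) (frame I y p)
          = (∑ l, inner ℝ (F.e i y) a * (F.alg.R i j k l).1 ⟨y, hy⟩ * inner ℝ (F.e l y) b)
            * if k = j then 1 else 0 := fun j ↦ by
        rw [← F.sum_inner_mul_inner hy (frame I y), Finset.sum_mul_sum, Finset.sum_comm]
        exact Finset.sum_congr rfl fun _ _ ↦ Finset.sum_congr rfl fun _ _ ↦ by ring
      simp only [e2, mul_ite, mul_one, mul_zero, Finset.sum_ite_eq, Finset.mem_univ, if_true]
  refine Finset.sum_comm.trans ?_
  simp only [e1]
  simp only [Finset.mul_sum, Finset.sum_mul]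
  refine Finset.sum_comm.trans ?_
  exact Finset.sum_congr rfl fun i _ ↦ Finset.sum_comm

end OrthoFrame

namespace OrthoFrame

open Matrix

variable {ι : Type*} [Fintype ι] [DecidableEq ι] (F : OrthoFrame I M ι)

theorem ric_eq_dotProduct {X Y : ∀ x : M, TangentSpace I x}
    (hX : ∀ y ∈ F.U, CMDiffAt ∞ (T% X) y) (hY : ∀ y ∈ F.U, CMDiffAt ∞ (T% Y) y) (y : F.U) :
    ric (y : M) (X y) (Y y) = (F.vec X hX ⬝ᵥ F.alg.ricM *ᵥ F.vec Y hY).1 y := by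
  rw [F.ric_eq y.2]
  simp only [dotProduct, mulVec, smoothFun.sum_apply, smoothFun.mul_apply, vec_apply,
    Finset.mul_sum, mul_assoc]

theorem nablaRic_eq {y : M} (hy : y ∈ F.U) (v a b : TangentSpace I y) :
    nablaRic y v a b = ∑ s, inner ℝ (F.e s y) v * ∑ i, ∑ j, inner ℝ (F.e i y) a *
      (F.alg.dm s F.alg.ricM i j).1 ⟨y, hy⟩ * inner ℝ (F.e j y) b := by
  obtain ⟨V₁, h₁, s₁⟩ := exists_contMDiffAt_extend a
  obtain ⟨V₂, h₂, s₂⟩ := exists_contMDiffAt_extend b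
  have h : F.U ⊓ (V₁ ⊓ V₂) ≤ F.U := inf_le_left
  have hy' : y ∈ F.U ⊓ (V₁ ⊓ V₂) := ⟨hy, h₁, h₂⟩
  let G := F.restrict h
  have hA : ∀ z ∈ G.U, CMDiffAt ∞ (T% (FiberBundle.extend E a)) z := fun z hz ↦ s₁ z hz.2.1
  have hB : ∀ z ∈ G.U, CMDiffAt ∞ (T% (FiberBundle.extend E b)) z := fun z hz ↦ s₂ z hz.2.2
  have e1 : ∀ s, mvfderiv I (fun z : M ↦ ric z (FiberBundle.extend E a z)
      (FiberBundle.extend E b z)) y (F.e s y)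
      = (G.alg.D s (G.vec _ hA ⬝ᵥ G.alg.ricM *ᵥ G.vec _ hB)).1 ⟨y, hy'⟩ := fun s ↦ by
    have hs := smoothFun.contMDiffAt_of_eq
      (u := fun z : M ↦ ric z (FiberBundle.extend E a z) (FiberBundle.extend E b z))
      _ fun z : G.U ↦ (G.ric_eq_dotProduct hA hB z).symm
    rw [← G.deriv_mk_apply s _ hs ⟨y, hy'⟩]
    exact congrArg (fun a ↦ (G.deriv s a).1 ⟨y, hy'⟩)
      (smoothFun.ext' (G.ric_eq_dotProduct hA hB))
  have e2 : ric y (nabla (FiberBundle.extend E a) y v) b = ∑ s, inner ℝ (F.e s y) v *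
      (G.alg.dv s (G.vec _ hA) ⬝ᵥ G.alg.ricM *ᵥ G.vec _ hB).1 ⟨y, hy'⟩ := by
    rw [G.ric_eq hy']
    simp only [G.inner_nabla_eq hA ⟨y, hy'⟩, dotProduct, mulVec, smoothFun.sum_apply,
      smoothFun.mul_apply, vec_apply, Finset.mul_sum, Finset.sum_mul,
      FiberBundle.extend_apply_self]
    exact (Finset.sum_comm.trans (Finset.sum_congr rfl fun i _ ↦ Finset.sum_comm.trans
      (Finset.sum_congr rfl fun j _ ↦ Finset.sum_congr rfl fun s _ ↦ by ring))).symm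
  have e3 : ric y a (nabla (FiberBundle.extend E b) y v) = ∑ s, inner ℝ (F.e s y) v *
      (G.vec _ hA ⬝ᵥ G.alg.ricM *ᵥ G.alg.dv s (G.vec _ hB)).1 ⟨y, hy'⟩ := by
    rw [G.ric_eq hy']
    simp only [G.inner_nabla_eq hB ⟨y, hy'⟩, dotProduct, mulVec, smoothFun.sum_apply,
      smoothFun.mul_apply, vec_apply, Finset.mul_sum, FiberBundle.extend_apply_self]
    exact (Finset.sum_comm.trans (Finset.sum_congr rfl fun i _ ↦ Finset.sum_comm.trans
      (Finset.sum_congr rfl fun j _ ↦ Finset.sum_congr rfl fun s _ ↦ by ring))).symm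
  rw [nablaRic, e2, e3, F.map_eq_sum hy]
  simp only [e1]
  rw [← Finset.sum_sub_distrib, ← Finset.sum_sub_distrib]
  refine Finset.sum_congr rfl fun s _ ↦ ?_
  rw [← mul_sub, ← mul_sub, ← smoothFun.sub_apply, ← smoothFun.sub_apply,
    FrameAlgebra.D_bilinear]
  congr 1
  simp only [dotProduct, mulVec, smoothFun.sum_apply, smoothFun.mul_apply, vec_apply,
    Finset.mul_sum, mul_assoc, G, FiberBundle.extend_apply_self]
  refine Finset.sum_congr rfl fun i _ ↦ Finset.sum_congr rfl fun j _ ↦ ?_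
  rw [F.restrict_dm_ricM_apply h s i j ⟨y, hy'⟩]

theorem inner_grad {u : M → ℝ} {y : M} (i : ι) :
    inner ℝ (F.e i y) (grad I u y) = mvfderiv I u y (F.e i y) := by
  rw [grad, inner_sum]
  conv_rhs => rw [← (frame I y).sum_repr' (F.e i y)]
  simp only [inner_smul_right, map_sum, map_smul, smul_eq_mul]
  exact Finset.sum_congr rfl fun p _ ↦ by rw [real_inner_comm]; ring

variable {u : M → ℝ} (hu : ∀ y ∈ F.U, CMDiffAt ∞ u y)

theorem inner_grad_eq (i : ι) (y : F.U) :
    inner ℝ (F.e i y) (grad I u (y : M)) = (F.alg.gr (smoothFun.mk u hu) i).1 y := by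
  rw [F.inner_grad]
  exact (F.deriv_mk_apply i u hu y).symm

theorem hess_eq (y : F.U) (a b : TangentSpace I (y : M)) :
    hess u (y : M) a b = ∑ i, ∑ j, inner ℝ (F.e i y) a * inner ℝ (F.e j y) b
      * (F.alg.dv i (F.alg.gr (smoothFun.mk u hu)) j).1 y := by
  have hg := F.contMDiffAt_of_inner (Y := grad I u) _ (F.inner_grad_eq hu)
  have hv := F.vec_eq hg (F.inner_grad_eq hu)
  rw [hess, F.inner_eq_sum y.2]
  simp only [F.inner_nabla_eq hg, hv, Finset.sum_mul]
  rw [Finset.sum_comm]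
  exact Finset.sum_congr rfl fun i _ ↦ Finset.sum_congr rfl fun j _ ↦ by ring

theorem driftLaplacian_eq {f : M → ℝ} (hf : ∀ y ∈ F.U, CMDiffAt ∞ f y) (y : F.U) :
    driftLaplacian I f u (y : M)
      = (F.alg.drift (smoothFun.mk f hf) (smoothFun.mk u hu)).1 y := by
  have e1 : ∑ p, hess u (y : M) (frame I (y : M) p) (frame I (y : M) p)
      = (F.alg.lap (smoothFun.mk u hu)).1 y := by
    have e2 : (F.alg.lap (smoothFun.mk u hu)).1 y
        = ∑ i, (F.alg.dv i (F.alg.gr (smoothFun.mk u hu)) i).1 y := smoothFun.sum_apply _ _ y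
    simp only [e2, F.hess_eq hu]
    refine Finset.sum_comm.trans (Finset.sum_congr rfl fun i _ ↦ ?_)
    refine Finset.sum_comm.trans ?_
    simp only [← Finset.sum_mul, F.sum_inner_mul_inner y.2, ite_mul, one_mul, zero_mul,
      Finset.sum_ite_eq, Finset.mem_univ, if_true]
  rw [driftLaplacian, e1, FrameAlgebra.drift, smoothFun.sub_apply, F.inner_eq_sum y.2,
    smoothFun.sum_apply]
  simp only [F.inner_grad_eq hu, F.inner_grad_eq hf, smoothFun.mul_apply]
  rfl

end OrthoFrame

/-! ### Existence of smooth orthonormal frames by Gram–Schmidt. -/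

theorem contMDiffAt_inner {X Y : ∀ x : M, TangentSpace I x} {y : M}
    (hX : CMDiffAt ∞ (T% X) y) (hY : CMDiffAt ∞ (T% Y) y) :
    CMDiffAt ∞ (fun z ↦ inner ℝ (X z) (Y z)) y :=
  ContMDiffAt.inner_bundle (F := E) (E := fun x : M ↦ TangentSpace I x) hX hY

theorem ContMDiffAt.inv_real {u : M → ℝ} {y : M} (hu : CMDiffAt ∞ u y) (h : u y ≠ 0) :
    CMDiffAt ∞ (fun z ↦ (u z)⁻¹) y :=
  (contDiffAt_inv ℝ h).contMDiffAt.comp y hu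

theorem contMDiffAt_norm_of_ne_zero {X : ∀ x : M, TangentSpace I x} {y : M}
    (hX : CMDiffAt ∞ (T% X) y) (h : X y ≠ 0) : CMDiffAt ∞ (fun z ↦ ‖X z‖) y := by
  have := (Real.contDiffAt_sqrt (n := ∞) (inner_self_ne_zero.2 h)).contMDiffAt.comp y
    (contMDiffAt_inner hX hX)
  simpa only [Function.comp_def, real_inner_self_eq_norm_sq, Real.sqrt_sq (norm_nonneg _)]
    using this

section GramSchmidt

open InnerProductSpace (gramSchmidt gramSchmidtNormed)

variable {n : ℕ} {v : Fin n → ∀ x : M, TangentSpace I x} {y : M}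

/-- Strong induction on the index: independence at `y` keeps the denominators of the projections
away from zero. -/
theorem contMDiffAt_gramSchmidt (hv : ∀ i, CMDiffAt ∞ (T% (v i)) y)
    (hl : LinearIndependent ℝ fun i ↦ v i y) (i : Fin n) :
    CMDiffAt ∞ (T% (fun z : M ↦ gramSchmidt ℝ (fun i ↦ v i z) i)) y := by
  induction i using WellFoundedLT.induction with
  | _ i ih =>
    have h0 : ∀ j, gramSchmidt ℝ (fun i ↦ v i y) j ≠ 0 := fun j ↦
      InnerProductSpace.gramSchmidt_ne_zero j hl
    have he : ∀ z : M, gramSchmidt ℝ (fun i ↦ v i z) i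
        = v i z - ∑ j ∈ Finset.Iio i,
          (inner ℝ (gramSchmidt ℝ (fun i ↦ v i z) j) (v i z)
            * (inner ℝ (gramSchmidt ℝ (fun i ↦ v i z) j) (gramSchmidt ℝ (fun i ↦ v i z) j))⁻¹)
            • gramSchmidt ℝ (fun i ↦ v i z) j := by
      intro z
      rw [InnerProductSpace.gramSchmidt_def]
      simp only [Submodule.starProjection_singleton, div_eq_mul_inv,
        real_inner_self_eq_norm_sq, RCLike.ofReal_real_eq_id, id_eq]
    simp only [he]
    refine (hv i).sub_section (.sum_section fun j hj ↦ ?_)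
    have hs := ih j (Finset.mem_Iio.1 hj)
    exact ((contMDiffAt_inner hs (hv i)).mul ((contMDiffAt_inner hs hs).inv_real
      (inner_self_ne_zero.2 (h0 j)))).smul_section hs

theorem contMDiffAt_gramSchmidtNormed (hv : ∀ i, CMDiffAt ∞ (T% (v i)) y)
    (hl : LinearIndependent ℝ fun i ↦ v i y) (i : Fin n) :
    CMDiffAt ∞ (T% (fun z : M ↦ gramSchmidtNormed ℝ (fun i ↦ v i z) i)) y := by
  have h0 := InnerProductSpace.gramSchmidt_ne_zero i hl
  have hs := contMDiffAt_gramSchmidt hv hl i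
  exact ((contMDiffAt_norm_of_ne_zero hs h0).inv_real (norm_ne_zero_iff.2 h0)).smul_section hs

end GramSchmidt

/-- Every orthonormal basis of a tangent space extends to a smooth orthonormal frame. -/
theorem OrthoFrame.exists_of_orthonormalBasis {n : ℕ} {x : M}
    (b : OrthonormalBasis (Fin n) ℝ (TangentSpace I x)) :
    ∃ F : OrthoFrame I M (Fin n), x ∈ F.U ∧ ∀ i, F.e i x = b i := by
  let v : Fin n → ∀ y : M, TangentSpace I y := fun i ↦ FiberBundle.extend E (b i)
  have hvx : ∀ i, v i x = b i := fun i ↦ FiberBundle.extend_apply_self E (b i)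
  let d : M → ℝ := fun y ↦ (Matrix.of fun i j ↦ inner ℝ (v i y) (v j y)).det
  have hd : ContinuousAt d x := by
    have : ContinuousAt (fun y ↦ (Matrix.of fun i j ↦ inner ℝ (v i y) (v j y))) x :=
      continuousAt_pi.2 fun i ↦ continuousAt_pi.2 fun j ↦
        (contMDiffAt_inner (OrthoFrame.contMDiffAt_extend (b i))
          (OrthoFrame.contMDiffAt_extend (b j))).continuousAt
    exact (continuous_id.matrix_det).continuousAt.comp this
  have hdx : d x ≠ 0 := by
    have : (Matrix.of fun i j ↦ inner ℝ (v i x) (v j x)) = 1 := by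
      ext i j
      simp only [Matrix.of_apply, hvx, Matrix.one_apply]
      exact orthonormal_iff_ite.1 b.orthonormal i j
    simp only [d, this, Matrix.det_one]
    exact one_ne_zero
  -- A nonzero Gram determinant is an open condition, so the extensions stay independent near `x`.
  have h1 : ∀ᶠ y in 𝓝 x, d y ≠ 0 := hd.eventually_ne hdx
  have h2 : ∀ i, ∀ᶠ y in 𝓝 x, CMDiffAt ∞ (T% (v i)) y := fun i ↦ by
    obtain ⟨V, hV, h⟩ := OrthoFrame.exists_contMDiffAt_extend (b i)
    filter_upwards [V.isOpen.mem_nhds hV] with y hy using h y hy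
  obtain ⟨V, hV, hVo, hx⟩ := eventually_nhds_iff.1 (h1.and (Filter.eventually_all.2 h2))
  have hl : ∀ y ∈ V, LinearIndependent ℝ fun i ↦ v i y := fun y hy ↦
    linearIndependent_of_det_ne_zero (hV y hy).1
  have ho : ∀ y ∈ V, Orthonormal ℝ (InnerProductSpace.gramSchmidtNormed ℝ fun i ↦ v i y) :=
    fun y hy ↦ InnerProductSpace.gramSchmidtNormed_orthonormal (hl y hy)
  have hn : n = Module.finrank ℝ E := by
    have : Module.finrank ℝ (TangentSpace I x) = Fintype.card (Fin n) :=
      Module.finrank_eq_card_basis b.toBasis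
    rw [Fintype.card_fin] at this
    exact this.symm
  refine ⟨⟨⟨V, hVo⟩, fun i y ↦ InnerProductSpace.gramSchmidtNormed ℝ (fun i ↦ v i y) i,
    fun i y hy ↦ contMDiffAt_gramSchmidtNormed (hV y hy).2 (hl y hy) i, ho, fun y hy w ↦ ?_⟩,
    hx, fun i ↦ ?_⟩
  · have : FiniteDimensional ℝ (TangentSpace I y) := inferInstanceAs (FiniteDimensional ℝ E)
    have hc : Fintype.card (Fin n) = Module.finrank ℝ (TangentSpace I y) := by
      rw [Fintype.card_fin]; exact hn
    have hspan := (ho y hy).linearIndependent.span_eq_top_of_card_eq_finrank' hc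
    have := (OrthonormalBasis.mk (ho y hy) hspan.ge).sum_repr' w
    simpa only [OrthonormalBasis.coe_mk] using this
  · have hp : Pairwise fun i j ↦ inner ℝ (v i x) (v j x) = 0 := fun i j hij ↦ by
      simp only [hvx]; exact b.orthonormal.2 hij
    have := InnerProductSpace.gramSchmidt_of_orthogonal ℝ hp
    change ((‖InnerProductSpace.gramSchmidt ℝ (fun i ↦ v i x) i‖ : ℝ))⁻¹
      • InnerProductSpace.gramSchmidt ℝ (fun i ↦ v i x) i = b i
    simp only [this]
    rw [hvx, b.orthonormal.1 i, inv_one, one_smul]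

/-! ### Pointwise invariants as traces of matrices in the frame. -/

namespace OrthoFrame

open Matrix

variable {ι κ : Type*} [Fintype ι] [DecidableEq ι] [Fintype κ] (F : OrthoFrame I M ι)

/-- The matrix of the Ricci tensor at a point. -/
def ricAt (y : F.U) : Matrix ι ι ℝ := fun i j ↦ (F.alg.ricM i j).1 y

/-- The matrices of the covariant derivatives of the Ricci tensor at a point. -/
def nablaRicAt (y : F.U) (s : ι) : Matrix ι ι ℝ := fun i j ↦ (F.alg.dm s F.alg.ricM i j).1 y

/-- The change of basis from the frame to an orthonormal basis of the tangent space. -/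
def changeBasis (y : F.U) (b : OrthonormalBasis κ ℝ (TangentSpace I (y : M))) : Matrix κ ι ℝ :=
  fun p i ↦ inner ℝ (F.e i y) (b p)

variable (y : F.U) (b : OrthonormalBasis κ ℝ (TangentSpace I (y : M)))

theorem changeBasis_transpose_mul : (F.changeBasis y b)ᵀ * F.changeBasis y b = 1 := by
  ext i j
  exact F.sum_inner_mul_inner y.2 b i j

theorem ric_basis (p q : κ) :
    ric (y : M) (b p) (b q) = (F.changeBasis y b * F.ricAt y * (F.changeBasis y b)ᵀ) p q := by
  rw [F.ric_eq y.2, mul_mul_transpose_apply]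
  rfl

theorem nablaRic_basis (s p q : κ) :
    nablaRic (y : M) (b s) (b p) (b q) = (F.changeBasis y b
      * (∑ r, F.changeBasis y b s r • F.nablaRicAt y r) * (F.changeBasis y b)ᵀ) p q := by
  rw [F.nablaRic_eq y.2, Matrix.mul_sum, Matrix.sum_mul, Matrix.sum_apply]
  refine Finset.sum_congr rfl fun r _ ↦ ?_
  rw [Matrix.mul_smul, Matrix.smul_mul, Matrix.smul_apply, mul_mul_transpose_apply]
  rfl

theorem nablaRicAt_symm (s i j : ι) : F.nablaRicAt y s i j = F.nablaRicAt y s j i :=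
  congrArg (fun a ↦ a.1 y) (F.alg.dm_ricM_symm s i j)

theorem nablaRic_symm {y : M} (hy : y ∈ F.U) (v a b : TangentSpace I y) :
    nablaRic y v a b = nablaRic y v b a := by
  rw [F.nablaRic_eq hy, F.nablaRic_eq hy]
  refine Finset.sum_congr rfl fun s _ ↦ congrArg _ (Finset.sum_comm.trans ?_)
  refine Finset.sum_congr rfl fun i _ ↦ Finset.sum_congr rfl fun j _ ↦ ?_
  rw [F.alg.dm_ricM_symm s i j]; ring

theorem scal_eq : scal I (y : M) = (F.ricAt y).trace := by
  simp only [scal, F.ric_basis y]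
  exact trace_mul_mul_transpose (F.changeBasis_transpose_mul y _) _

theorem trRicCubed_eq : trRicCubed I (y : M) = (F.ricAt y * F.ricAt y * F.ricAt y).trace := by
  have hQ := F.changeBasis_transpose_mul y (frame I (y : M))
  rw [← trace_mul_mul_transpose hQ, ← conj_mul_conj hQ, ← conj_mul_conj hQ, trace_mul_mul]
  simp only [trRicCubed, F.ric_basis y]

theorem nablaRicNormSq_eq :
    nablaRicNormSq I (y : M) = ∑ s, (F.nablaRicAt y s * F.nablaRicAt y s).trace := by
  have hQ := F.changeBasis_transpose_mul y (frame I (y : M))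
  rw [← sum_trace_mul_self_conj hQ, nablaRicNormSq]
  simp only [trace, diag, mul_apply (N := _ * _), ← F.nablaRic_basis y]
  refine Finset.sum_congr rfl fun s _ ↦ Finset.sum_congr rfl fun i _ ↦
    Finset.sum_congr rfl fun j _ ↦ ?_
  rw [sq, F.nablaRic_symm y.2 _ (frame I (y : M) j)]

theorem sum_nablaRic_nablaRic_ric :
    ∑ s, ∑ i, ∑ j, ∑ k, nablaRic (y : M) (b s) (b i) (b j) * nablaRic (y : M) (b s) (b j) (b k)
      * ric (y : M) (b k) (b i)
      = ∑ s, (F.nablaRicAt y s * F.nablaRicAt y s * F.ricAt y).trace := by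
  rw [← sum_trace_mul_conj (F.changeBasis_transpose_mul y b)]
  simp only [trace_mul_mul, F.ric_basis y, F.nablaRic_basis y]

end OrthoFrame

/-! ### Transfer of the soliton equations to the frame algebra. -/

namespace OrthoFrame

open Matrix

variable {ι : Type*} [Fintype ι] [DecidableEq ι] (F : OrthoFrame I M ι)

theorem isSoliton_alg {f : M → ℝ} (hf : IsNormalizedShrinkingSoliton I f)
    (hS : ∀ x : M, scal I x = 1) :
    F.alg.IsSoliton (smoothFun.mk f fun y _ ↦ hf.smooth y) where
  eqn i j := smoothFun.ext' fun y ↦ by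
    have h := hf.soliton y (F.e i y) (F.e j y)
    rw [F.ric_eq y.2, F.hess_eq (fun y _ ↦ hf.smooth y)] at h
    simp only [F.inner_e y.2, ite_mul, mul_ite, one_mul, zero_mul, mul_one, mul_zero,
      Finset.sum_ite_eq', Finset.mem_univ, if_true] at h
    refine h.trans ?_
    split_ifs <;> rfl
  normalized := smoothFun.ext' fun y ↦ by
    rw [smoothFun.sum_apply]
    simp only [smoothFun.mul_apply, ← F.inner_grad_eq]
    rw [← F.inner_eq_sum y.2, real_inner_self_eq_norm_sq]
    exact hf.normalized y
  scal := smoothFun.ext' fun y ↦ by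
    have h := hS y
    rw [F.scal_eq y] at h
    exact (smoothFun.sum_apply _ _ y).trans h

theorem trace_cube_apply (y : F.U) : (F.alg.ricM * F.alg.ricM * F.alg.ricM).trace.1 y
    = (F.ricAt y * F.ricAt y * F.ricAt y).trace := by
  have h : ∀ A : Matrix ι ι (smoothFun I F.U), A.trace.1 y
      = (A.map (smoothFun.eval I y)).trace := fun A ↦ smoothFun.sum_apply _ _ y
  rw [h, Matrix.map_mul, Matrix.map_mul]
  rfl

/-- On `U` the function `trRicCubed` is the trace of a matrix over the algebra, hence smooth, and
the abstract drifted Laplacian applies. -/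
theorem driftLaplacian_trRicCubed {f : M → ℝ} (hf : IsNormalizedShrinkingSoliton I f)
    (y : F.U) :
    driftLaplacian I f (trRicCubed I) (y : M) = (F.alg.drift
      (smoothFun.mk f fun y _ ↦ hf.smooth y) (F.alg.ricM * F.alg.ricM * F.alg.ricM).trace).1 y := by
  have h : ∀ y : F.U, (F.alg.ricM * F.alg.ricM * F.alg.ricM).trace.1 y = trRicCubed I (y : M) :=
    fun y ↦ by rw [F.trRicCubed_eq y, F.trace_cube_apply]
  have hu := smoothFun.contMDiffAt_of_eq _ h
  rw [F.driftLaplacian_eq hu (fun y _ ↦ hf.smooth y)]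
  exact congrArg (fun a ↦ (F.alg.drift _ a).1 y)
    (smoothFun.ext' (a := smoothFun.mk (trRicCubed I) hu) fun z ↦ (h z).symm)

end OrthoFrame

/-! ### The identity at a point, in an eigenbasis of Ric. -/

/-- The spectral theorem for the operator representing Ric, which is self-adjoint by the pair
symmetry of the curvature. -/
theorem exists_orthonormalBasis_ric_diagonal {n : ℕ} {x : M}
    (e : OrthonormalBasis (Fin n) ℝ (TangentSpace I x)) :
    ∃ (b : OrthonormalBasis (Fin n) ℝ (TangentSpace I x)) (l : Fin n → ℝ),
      ∀ i j, ric x (b i) (b j) = if i = j then l i else 0 := by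
  obtain ⟨F, hx, -⟩ := OrthoFrame.exists_of_orthonormalBasis e
  have hs : ∀ a b, ric x a b = ric x b a := fun a b ↦ by
    rw [F.ric_eq hx, F.ric_eq hx]
    refine Finset.sum_comm.trans ?_
    refine Finset.sum_congr rfl fun i _ ↦ Finset.sum_congr rfl fun j _ ↦ ?_
    rw [F.alg.ricM_symm i j]; ring
  let L : TangentSpace I x →ₗ[ℝ] TangentSpace I x :=
    { toFun v := ∑ i, (∑ j, (F.alg.ricM i j).1 ⟨x, hx⟩ * inner ℝ (F.e j x) v) • F.e i x
      map_add' v w := by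
        simp only [inner_add_right, mul_add, Finset.sum_add_distrib, add_smul]
      map_smul' r v := by
        simp only [inner_smul_right, Finset.smul_sum, smul_smul, Finset.mul_sum, RingHom.id_apply,
          mul_left_comm] }
  have hL : ∀ a b, inner ℝ a (L b) = ric x a b := fun a b ↦ by
    rw [F.ric_eq hx]
    simp only [L, LinearMap.coe_mk, AddHom.coe_mk, inner_sum, inner_smul_right, Finset.sum_mul]
    refine Finset.sum_congr rfl fun i _ ↦ Finset.sum_congr rfl fun j _ ↦ ?_
    rw [real_inner_comm (F.e i x) a]; ring
  have hsym : L.IsSymmetric := fun a b ↦ by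
    rw [real_inner_comm, hL, hL, hs]
  have : FiniteDimensional ℝ (TangentSpace I x) := inferInstanceAs (FiniteDimensional ℝ E)
  have hn : Module.finrank ℝ (TangentSpace I x) = n := by
    rw [Module.finrank_eq_card_basis e.toBasis, Fintype.card_fin]
  refine ⟨hsym.eigenvectorBasis hn, hsym.eigenvalues hn, fun i j ↦ ?_⟩
  rw [← hL, hsym.apply_eigenvectorBasis, inner_smul_right,
    orthonormal_iff_ite.1 (hsym.eigenvectorBasis hn).orthonormal]
  split_ifs with h
  · subst h; simp
  · simp

/-- A vanishing eigenvalue of the Ricci tensor. -/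
theorem FrameAlgebra.IsSoliton.exists_eigenvalue_eq_zero {A ι : Type*} [CommRing A] [Algebra ℝ A]
    [Fintype ι] [DecidableEq ι] {F : FrameAlgebra A ι} {f : A} (h : F.IsSoliton f)
    (φ : A →ₐ[ℝ] ℝ) {l : ι → ℝ} (hl : ∀ i j, φ (F.ricM i j) = if i = j then l i else 0)
    (hc : Fintype.card ι ≠ 2) : ∃ p, l p = 0 := by
  by_contra! h0
  -- If no eigenvalue vanishes, Ric(∇f) = 0 forces ∇f = 0 at the point.
  have h1 : ∀ i, φ (F.gr f i) = 0 := fun i ↦ by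
    have := congrArg φ (congrFun h.ricM_mulVec_gr i)
    simpa [Matrix.mulVec, dotProduct, hl, h0] using this
  -- Where ∇f = 0, `dm_ricM_gr` reads λ² = λ/2.
  have h2 : ∀ i, l i = 1 / 2 := fun i ↦ by
    have := congrArg φ (h.dm_ricM_gr i i)
    simp only [map_sum, map_mul, map_sub, h1, hl, AlgHom.commutes, mul_zero, if_true,
      Finset.sum_const_zero, mul_ite, ite_mul, zero_mul, Finset.sum_ite_eq, Finset.mem_univ,
      Algebra.algebraMap_self, RingHom.id_apply] at this
    have h3 : l i * (l i - 1 / 2) = 0 := by linear_combination -this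
    exact sub_eq_zero.1 ((mul_eq_zero.1 h3).resolve_left (h0 i))
  have h3 := congrArg φ h.scal
  simp only [Matrix.trace, Matrix.diag, map_sum, hl, if_true, h2, map_one, Finset.sum_const,
    Finset.card_univ, nsmul_eq_mul] at h3
  refine hc ?_
  have : (Fintype.card ι : ℝ) = 2 := by linarith
  exact_mod_cast this

/-- The pointwise content of the soliton equations of scalar curvature one in dimension four, in
an orthonormal frame diagonalizing the Ricci tensor at a point. -/
theorem FrameAlgebra.IsSoliton.drift_trace_cube_eval {A : Type*} [CommRing A] [Algebra ℝ A]
    {F : FrameAlgebra A (Fin 4)} {f : A} (h : F.IsSoliton f) (φ : A →ₐ[ℝ] ℝ) {l : Fin 4 → ℝ}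
    (hl : ∀ i j, φ (F.ricM i j) = if i = j then l i else 0) :
    φ (F.drift f (F.ricM * F.ricM * F.ricM).trace)
      = 4 * φ (F.ricM * F.ricM * F.ricM).trace - 1
        - (3 / 2) * φ (∑ s, (F.dm s F.ricM * F.dm s F.ricM).trace)
        + 6 * φ (∑ s, (F.dm s F.ricM * F.dm s F.ricM * F.ricM).trace) ∧ ∀ i, 0 ≤ l i := by
  obtain ⟨p, hp⟩ := h.exists_eigenvalue_eq_zero φ hl (by simp)
  have h1 : ∑ i, l i = 1 := by
    simpa [Matrix.trace, hl] using congrArg φ h.scal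
  have h2 : ∑ i, l i ^ 2 = 1 / 2 := by
    have := congrArg φ h.trace_sq
    simpa [Matrix.trace, Matrix.mul_apply, hl, sq] using this
  refine ⟨?_, nonneg_of_sum_sq ⟨p, hp⟩ h1 h2⟩
  -- Because Ric is diagonal at the point, both curvature traces see only these components.
  let K : Fin 4 → Fin 4 → ℝ := fun i j ↦ φ (F.R i j j i)
  have hK : ∀ i j, K i j = K j i := fun i j ↦ by
    simp only [K]; rw [F.R_pair i j j i]
  have hd : ∀ i, K i i = 0 := fun i ↦ by
    have := congrArg φ (F.R_swap i i i i)
    rw [map_neg] at this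
    simp only [K]; linarith
  have hs : ∀ j, ∑ i, K i j = l j := fun j ↦ by
    have := hl j j
    rw [FrameAlgebra.ricM_apply, map_sum, if_pos rfl] at this
    exact this
  have hr : ∀ j, φ (F.rmRic j j) = ∑ i, K i j * l i := fun j ↦ by
    simp [FrameAlgebra.rmRic, hl, K]
  have h3 : φ (F.ricM * F.ricM * F.ricM).trace = ∑ i, l i ^ 3 := by
    simp [Matrix.trace, Matrix.mul_apply, hl, pow_succ]
  have h4 : φ (F.ricM * F.ricM * F.rmRic).trace = ∑ i, ∑ j, K i j * l i * l j ^ 2 := by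
    rw [Finset.sum_comm]
    simp [Matrix.trace, Matrix.mul_apply, hl, hr, Finset.mul_sum, sq]
    exact Finset.sum_congr rfl fun _ _ ↦ Finset.sum_congr rfl fun _ _ ↦ by ring
  have h5 : φ (F.ricM * F.rmRic).trace = ∑ i, ∑ j, K i j * l i * l j := by
    rw [Finset.sum_comm]
    simp [Matrix.trace, Matrix.mul_apply, hl, hr, Finset.mul_sum]
    exact Finset.sum_congr rfl fun _ _ ↦ Finset.sum_congr rfl fun _ _ ↦ by ring
  have h6 := curvature_sum_identity hK hd hs ⟨p, hp⟩ h1 h2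
  rw [h.drift_trace_cube, h.norm_dm_ricM]
  simp only [map_add, map_sub, map_mul, map_ofNat, h3, h4, h5, AlgHom.commutes,
    Algebra.algebraMap_self, RingHom.id_apply]
  linear_combination h6

end

/-! ### Conclusion on the manifold. -/

theorem proposition3p1 {M : Type*} [EMetricSpace M]
    [ChartedSpace (EuclideanSpace ℝ (Fin 4)) M] [IsManifold (𝓡 4) ∞ M]
    [RiemannianBundle (fun x : M ↦ TangentSpace (𝓡 4) x)]
    [IsContMDiffRiemannianBundle (𝓡 4) ∞ (EuclideanSpace ℝ (Fin 4))
      (fun x : M ↦ TangentSpace (𝓡 4) x)]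
    [IsRiemannianManifold (𝓡 4) M] [CompleteSpace M]
    (f : M → ℝ) (hf : IsNormalizedShrinkingSoliton (𝓡 4) f)
    (hS : ∀ x : M, scal (𝓡 4) x = 1) :
    (∀ (x : M) (e : OrthonormalBasis (Fin 4) ℝ (TangentSpace (𝓡 4) x)),
      driftLaplacian (𝓡 4) f (trRicCubed (𝓡 4)) x
        = 4 * trRicCubed (𝓡 4) x - 1 - (3 / 2) * nablaRicNormSq (𝓡 4) x
          + 6 * ∑ s, ∑ i, ∑ j, ∑ k,
            nablaRic x (e s) (e i) (e j) * nablaRic x (e s) (e j) (e k) * ric x (e k) (e i)) ∧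
    (∀ (x : M) (v : TangentSpace (𝓡 4) x), 0 ≤ ric x v v) ∧
    (∀ x : M, 4 * trRicCubed (𝓡 4) x - 1 - (3 / 2) * nablaRicNormSq (𝓡 4) x
      ≤ driftLaplacian (𝓡 4) f (trRicCubed (𝓡 4)) x) := by
  -- For each point, a smooth frame is taken that diagonalizes Ric at that point only.
  have key : ∀ x : M, ∃ (F : OrthoFrame (𝓡 4) M (Fin 4)) (hx : x ∈ F.U) (l : Fin 4 → ℝ),
      (∀ i j, F.ricAt ⟨x, hx⟩ i j = if i = j then l i else 0) ∧ (∀ i, 0 ≤ l i) ∧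
      driftLaplacian (𝓡 4) f (trRicCubed (𝓡 4)) x
        = 4 * trRicCubed (𝓡 4) x - 1 - (3 / 2) * nablaRicNormSq (𝓡 4) x
          + 6 * ∑ s, (F.nablaRicAt ⟨x, hx⟩ s * F.nablaRicAt ⟨x, hx⟩ s
            * F.ricAt ⟨x, hx⟩).trace := fun x ↦ by
    have hn : Module.finrank ℝ (TangentSpace (𝓡 4) x) = 4 := finrank_euclideanSpace_fin
    obtain ⟨b, l, hb⟩ := exists_orthonormalBasis_ric_diagonal
      ((frame (𝓡 4) x).reindex (finCongr hn))
    obtain ⟨F, hx, hF⟩ := OrthoFrame.exists_of_orthonormalBasis b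
    have hl : ∀ i j, F.ricAt ⟨x, hx⟩ i j = if i = j then l i else 0 := fun i j ↦ by
      have h := hb i j
      rw [← hF, ← hF, F.ric_eq hx] at h
      simp only [F.inner_e hx, ite_mul, mul_ite, one_mul, zero_mul, mul_one, mul_zero,
        Finset.sum_ite_eq', Finset.mem_univ, if_true] at h
      exact h
    obtain ⟨h1, h2⟩ := (F.isSoliton_alg hf hS).drift_trace_cube_eval
      (smoothFun.eval (𝓡 4) ⟨x, hx⟩) hl
    refine ⟨F, hx, l, hl, h2, ?_⟩
    rw [F.driftLaplacian_trRicCubed hf ⟨x, hx⟩, F.trRicCubed_eq ⟨x, hx⟩,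
      F.nablaRicNormSq_eq ⟨x, hx⟩, ← F.trace_cube_apply]
    have h3 : ∀ A : Matrix (Fin 4) (Fin 4) (smoothFun (𝓡 4) F.U),
        smoothFun.eval (𝓡 4) ⟨x, hx⟩ A.trace = (A.map (smoothFun.eval (𝓡 4) ⟨x, hx⟩)).trace :=
      fun A ↦ map_sum _ _ _
    have h4 : smoothFun.eval (𝓡 4) ⟨x, hx⟩
        (∑ s, (F.alg.dm s F.alg.ricM * F.alg.dm s F.alg.ricM).trace)
        = ∑ s, (F.nablaRicAt ⟨x, hx⟩ s * F.nablaRicAt ⟨x, hx⟩ s).trace := by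
      simp only [map_sum, h3, Matrix.map_mul]
      rfl
    have h5 : smoothFun.eval (𝓡 4) ⟨x, hx⟩
        (∑ s, (F.alg.dm s F.alg.ricM * F.alg.dm s F.alg.ricM * F.alg.ricM).trace)
        = ∑ s, (F.nablaRicAt ⟨x, hx⟩ s * F.nablaRicAt ⟨x, hx⟩ s * F.ricAt ⟨x, hx⟩).trace := by
      simp only [map_sum, h3, Matrix.map_mul]
      rfl
    rw [← h4, ← h5]
    exact h1
  refine ⟨fun x e ↦ ?_, fun x v ↦ ?_, fun x ↦ ?_⟩
  · obtain ⟨F, hx, l, -, -, h⟩ := key x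
    rw [h, F.sum_nablaRic_nablaRic_ric ⟨x, hx⟩ e]
  · obtain ⟨F, hx, l, hl, h0, -⟩ := key x
    rw [F.ric_eq hx]
    refine Finset.sum_nonneg fun i _ ↦ ?_
    have : ∀ j, (F.alg.ricM i j).1 ⟨x, hx⟩ = if i = j then l i else 0 := hl i
    simp only [this, mul_ite, ite_mul, mul_zero, zero_mul, Finset.sum_ite_eq, Finset.mem_univ,
      if_true]
    rw [mul_right_comm]
    exact mul_nonneg (mul_self_nonneg _) (h0 i)
  · obtain ⟨F, hx, l, hl, h0, h⟩ := key x
    rw [h]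
    -- In this frame the cubic gradient term is ∑ λ_k (∇_s R_jk)², nonnegative because every λ_k is.
    refine le_add_of_nonneg_right (mul_nonneg (by norm_num) (Finset.sum_nonneg fun s _ ↦ ?_))
    rw [Matrix.trace_mul_mul]
    refine Finset.sum_nonneg fun i _ ↦ Finset.sum_nonneg fun j _ ↦ Finset.sum_nonneg fun k _ ↦ ?_
    rw [hl]
    split_ifs with hk
    · subst hk
      rw [F.nablaRicAt_symm _ s j k]
      exact mul_nonneg (mul_self_nonneg _) (h0 k)
    · rw [mul_zero]
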